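/- Let $\Sigma_3=\{a<b<c\}$. The Parikh matrix $\Psi(w)$ of a word $w\in\Sigma_3^*$ is the product, in order, of the matrices of its letters, where the first, second and third letters $a,b,c$ are sent to the $4\times 4$ matrices $I+E_{1,2}$, $I+E_{2,3}$, $I+E_{3,4}$ respectively ($I$ is the identity matrix and $E_{i,j}$ is the matrix whose only nonzero entry is a $1$ in position $(i,j)$). The $M$-class of $w$ is $[w]=\{w'\in\Sigma_3^* : \Psi(w')=\Psi(w)\}$, and $w$ is called $M$-ambiguous if $[w]$ contains a word different from $w$. All words of $[w]$ have the same length; for two words $w',w''$ of the same length let $d_H(w',w'')$ be their Hamming distance, that is, the number of positions at which they differ. For an $M$-ambiguous word $w$ put \[ d_H([w])=\min\{\,d_H(w',w'') : w',w''\in[w],\ w'\neq w''\,\}. \] Theorem. For every $M$-ambiguous word $w\in\Sigma_3^*$ one has $d_H([w])\in\{2,4,7,8\}$. -/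

import Mathlib

/-- The image of the letter `a_q` under the Parikh matrix mapping: the identity matrix with an
additional `1` in the entry immediately to the right of the `q`-th diagonal entry. Words over the
ordered alphabet `a_1 < ⋯ < a_s` are lists over `Fin s`. -/
def parikhLetter {s : ℕ} (q : Fin s) : Matrix (Fin (s + 1)) (Fin (s + 1)) ℕ :=
  1 + Matrix.single q.castSucc q.succ 1

/-- The Parikh matrix of a word: the product of the matrices of its letters, in order. -/
def parikhMatrix {s : ℕ} (w : List (Fin s)) : Matrix (Fin (s + 1)) (Fin (s + 1)) ℕ :=
  (w.map parikhLetter).prod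

/-- Two words are `M`-equivalent if they have the same Parikh matrix. -/
def MEquiv {s : ℕ} (w w' : List (Fin s)) : Prop :=
  parikhMatrix w = parikhMatrix w'

/-- The `M`-class of a word. -/
def MClass {s : ℕ} (w : List (Fin s)) : Set (List (Fin s)) :=
  {w' | MEquiv w w'}

/-- A word is `M`-ambiguous if it is `M`-equivalent to a word different from itself. -/
def MAmbiguous {s : ℕ} (w : List (Fin s)) : Prop :=
  ∃ w' : List (Fin s), w' ≠ w ∧ MEquiv w w'

/-- The Hamming distance of two words of the same length: the number of positions at which their
letters differ. (It is only used for `M`-equivalent words, which have the same length.) -/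
def wordHammingDist {α : Type*} [DecidableEq α] (w w' : List α) : ℕ :=
  (w.zip w').countP (fun p => p.1 ≠ p.2)

/-- The set of Hamming distances between two distinct words of the `M`-class of `w`. -/
def classDistances {s : ℕ} (w : List (Fin s)) : Set ℕ :=
  {d | ∃ w' ∈ MClass w, ∃ w'' ∈ MClass w, w' ≠ w'' ∧ wordHammingDist w' w'' = d}

/-- The minimal Hamming distance of the `M`-class of `w`. -/
noncomputable def minHammingDist {s : ℕ} (w : List (Fin s)) : ℕ :=
  sInf (classDistances w)

/-- For an `M`-ambiguous word the minimal Hamming distance is an attained minimum. -/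
theorem isLeast_minHammingDist {s : ℕ} {w : List (Fin s)} (hw : MAmbiguous w) :
    IsLeast (classDistances w) (minHammingDist w) := by
  obtain ⟨w', hne, h⟩ := hw
  have hmem : wordHammingDist w' w ∈ classDistances w := ⟨w', h, w, rfl, hne, rfl⟩
  exact ⟨Nat.sInf_mem ⟨_, hmem⟩, fun _ hd => Nat.sInf_le hd⟩

/-! Distinct M-equivalent words never differ in exactly 0, 1 or 3 positions, so only classes whose
distances all exceed 4 (`Sparse`) need work. In such a class any two distinct words turn out to be
at distance 7 or 8.

Describe a word with B letters b by the multisets A and C of the heights of its a's and c's, the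
height of a letter being the number of b's to its left. M-equivalence fixes B, the sizes and sums of
A and C, and the sum of (k - h)⁺ over h in A and k in C. Passing to (A', C') is therefore encoded by
functions f and g that vanish at 0 and from B on and have discrete Laplacians A' - A and C' - C
(`ramp_transport`). The abc-count says that the sum of f over C' plus the sum of g over A is zero
(`sum_ramp_sub_eq_zero`).

Sparseness forbids a and c from being adjacent, forbids moving two equal outer letters in opposite
directions when the other outer letter does not occur between them, and constrains factors
x..y..x..y..x. Hence A and C nearly interlace with small gaps (`Sparse.rigid_heights`). A maximum
principle now applies. A positive maximum of f is a plateau with ends in A and an element of C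
inside (`Transport.exists_peak`); a negative value forces a gap of at least 3 in A
(`Transport.exists_valley`). Rigidity does not let both occur, so f and g each have constant sign.
Equal signs contradict the abc identity. Opposite signs, once common first and last letters are
stripped, leave exactly two a's and two c's in alternation (`Transport.length_eq_two`), where
equivalent words form an explicit one-parameter family. -/

/-! ### Parikh matrices as subword counts -/

/-- The number of occurrences of `ab` as a scattered subword. -/
def abCount : List (Fin 3) → ℕ
  | [] => 0
  | l :: w => (if l = 0 then w.count 1 else 0) + abCount w

/-- The number of occurrences of `bc` as a scattered subword. -/
def bcCount : List (Fin 3) → ℕ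
  | [] => 0
  | l :: w => (if l = 1 then w.count 2 else 0) + bcCount w

/-- The number of occurrences of `abc` as a scattered subword. -/
def abcCount : List (Fin 3) → ℕ
  | [] => 0
  | l :: w => (if l = 0 then bcCount w else 0) + abcCount w

theorem parikhMatrix_eq (w : List (Fin 3)) :
    parikhMatrix w = !![1, w.count 0, abCount w, abcCount w; 0, 1, w.count 1, bcCount w;
      0, 0, 1, w.count 2; 0, 0, 0, 1] := by
  induction w with
  | nil =>
    ext i j
    fin_cases i <;> fin_cases j <;> simp [parikhMatrix, abCount, bcCount, abcCount]
  | cons l w ih =>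
    have h : parikhMatrix (l :: w) = parikhLetter l * parikhMatrix w := by simp [parikhMatrix]
    rw [h, ih]
    ext i j
    fin_cases l <;> fin_cases i <;> fin_cases j <;>
      simp [Matrix.mul_apply, Fin.sum_univ_four, parikhLetter, abCount, bcCount, abcCount,
        Matrix.one_apply, Matrix.single_apply, Fin.ext_iff, add_comm]

theorem mEquiv_iff {u v : List (Fin 3)} : MEquiv u v ↔ u.count 0 = v.count 0 ∧
    u.count 1 = v.count 1 ∧ u.count 2 = v.count 2 ∧ abCount u = abCount v ∧
    bcCount u = bcCount v ∧ abcCount u = abcCount v := by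
  rw [MEquiv, parikhMatrix_eq, parikhMatrix_eq]
  constructor
  · intro h
    refine ⟨?_, ?_, ?_, ?_, ?_, ?_⟩
    · simpa using congrFun (congrFun h 0) 1
    · simpa using congrFun (congrFun h 1) 2
    · simpa using congrFun (congrFun h 2) 3
    · simpa using congrFun (congrFun h 0) 2
    · simpa using congrFun (congrFun h 1) 3
    · simpa using congrFun (congrFun h 0) 3
  · rintro ⟨h1, h2, h3, h4, h5, h6⟩
    rw [h1, h2, h3, h4, h5, h6]

theorem abCount_append (u v : List (Fin 3)) :
    abCount (u ++ v) = abCount u + abCount v + u.count 0 * v.count 1 := by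
  induction u with
  | nil => simp [abCount]
  | cons l u ih => fin_cases l <;> simp [abCount, ih] <;> ring

theorem bcCount_append (u v : List (Fin 3)) :
    bcCount (u ++ v) = bcCount u + bcCount v + u.count 1 * v.count 2 := by
  induction u with
  | nil => simp [bcCount]
  | cons l u ih => fin_cases l <;> simp [bcCount, ih] <;> ring

theorem abcCount_append (u v : List (Fin 3)) : abcCount (u ++ v) =
    abcCount u + abcCount v + abCount u * v.count 2 + u.count 0 * bcCount v := by
  induction u with
  | nil => simp [abcCount, abCount]
  | cons l u ih => fin_cases l <;> simp [abcCount, abCount, bcCount_append, ih] <;> ring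

theorem abCount_replicate_one (n : ℕ) : abCount (List.replicate n 1) = 0 := by
  induction n with
  | zero => rfl
  | succ n ih => simp [List.replicate_succ, abCount, ih]

theorem bcCount_replicate_one (n : ℕ) : bcCount (List.replicate n 1) = 0 := by
  induction n with
  | zero => rfl
  | succ n ih => simp [List.replicate_succ, bcCount, ih, List.count_replicate]

theorem abcCount_replicate_one (n : ℕ) : abcCount (List.replicate n 1) = 0 := by
  induction n with
  | zero => rfl
  | succ n ih => simp [List.replicate_succ, abcCount, ih]

theorem abCount_eq_zero {w : List (Fin 3)} (h : (0 : Fin 3) ∉ w) : abCount w = 0 := by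
  induction w with
  | nil => rfl
  | cons l w ih =>
    simp only [List.mem_cons, not_or] at h
    simp [abCount, ih h.2, Ne.symm h.1]

theorem bcCount_eq_zero {w : List (Fin 3)} (h : (2 : Fin 3) ∉ w) : bcCount w = 0 := by
  induction w with
  | nil => rfl
  | cons l w ih =>
    simp only [List.mem_cons, not_or] at h
    simp [bcCount, ih h.2, List.count_eq_zero.2 h.2]

theorem abcCount_eq_zero {w : List (Fin 3)} (h : (0 : Fin 3) ∉ w ∨ (2 : Fin 3) ∉ w) :
    abcCount w = 0 := by
  induction w with
  | nil => rfl
  | cons l w ih =>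
    simp only [List.mem_cons, not_or] at h
    rcases h with h | h
    · simp [abcCount, ih (Or.inl h.2), Ne.symm h.1]
    · simp [abcCount, ih (Or.inr h.2), bcCount_eq_zero h.2]

/-! ### M-equivalence: congruence and cancellation -/

section MEquiv

variable {s : ℕ} {u v w : List (Fin s)}

theorem MEquiv.symm (h : MEquiv u v) : MEquiv v u := Eq.symm h

theorem MEquiv.trans (h : MEquiv u v) (h' : MEquiv v w) : MEquiv u w := Eq.trans h h'

theorem parikhMatrix_append (u v : List (Fin s)) :
    parikhMatrix (u ++ v) = parikhMatrix u * parikhMatrix v := by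
  simp [parikhMatrix]

theorem MEquiv.context (h : MEquiv u v) (p q : List (Fin s)) :
    MEquiv (p ++ u ++ q) (p ++ v ++ q) := by
  simp only [MEquiv, parikhMatrix_append] at *
  rw [h]

end MEquiv

theorem MEquiv.length_eq {u v : List (Fin 3)} (h : MEquiv u v) : u.length = v.length := by
  have key : ∀ w : List (Fin 3), w.length = w.count 0 + w.count 1 + w.count 2 := by
    intro w
    induction w with
    | nil => rfl
    | cons l w ih => fin_cases l <;> simp [ih] <;> ring
  obtain ⟨h0, h1, h2, -⟩ := mEquiv_iff.1 h
  rw [key, key, h0, h1, h2]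

theorem MEquiv.of_cons {l : Fin 3} {u v : List (Fin 3)} (h : MEquiv (l :: u) (l :: v)) :
    MEquiv u v := by
  rw [mEquiv_iff] at *
  fin_cases l <;> simp [abCount, bcCount, abcCount] at * <;> omega

theorem MEquiv.of_concat {l : Fin 3} {u v : List (Fin 3)} (h : MEquiv (u ++ [l]) (v ++ [l])) :
    MEquiv u v := by
  rw [mEquiv_iff] at *
  simp only [abCount_append, bcCount_append, abcCount_append, List.count_append] at h
  fin_cases l <;> simp [abCount, bcCount, abcCount] at * <;> omega

/-! ### Hamming distance, and the impossible distances 0, 1, 3 -/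

section Hamming

variable {α : Type*} [DecidableEq α]

theorem wordHammingDist_cons (x y : α) (u v : List α) :
    wordHammingDist (x :: u) (y :: v) = wordHammingDist u v + if x = y then 0 else 1 := by
  by_cases h : x = y <;> simp [wordHammingDist, h]

theorem wordHammingDist_nil : wordHammingDist ([] : List α) [] = 0 := rfl

theorem wordHammingDist_append {p q : List α} (h : p.length = q.length) (u v : List α) :
    wordHammingDist (p ++ u) (q ++ v) = wordHammingDist p q + wordHammingDist u v := by
  simp [wordHammingDist, List.zip_append h]

theorem wordHammingDist_self (u : List α) : wordHammingDist u u = 0 := by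
  induction u with
  | nil => rfl
  | cons l u ih => simp [wordHammingDist_cons, ih]

theorem wordHammingDist_comm (u v : List α) : wordHammingDist u v = wordHammingDist v u := by
  induction u generalizing v with
  | nil => simp [wordHammingDist]
  | cons l u ih =>
    cases v with
    | nil => simp [wordHammingDist]
    | cons m v => rw [wordHammingDist_cons, wordHammingDist_cons, ih]; simp [eq_comm]

theorem eq_of_wordHammingDist_eq_zero {u v : List α} (hl : u.length = v.length)
    (h : wordHammingDist u v = 0) : u = v := by
  induction u generalizing v with
  | nil => simpa using hl.symm
  | cons l u ih =>
    cases v with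
    | nil => simp at hl
    | cons m v =>
      rw [wordHammingDist_cons] at h
      by_cases hlm : l = m
      · rw [hlm, ih (by simpa using hl) (by omega)]
      · simp [hlm] at h

theorem exists_split_of_wordHammingDist {u v : List α} (hl : u.length = v.length) {n : ℕ}
    (h : wordHammingDist u v = n + 1) : ∃ p x y u' v', u = p ++ x :: u' ∧ v = p ++ y :: v' ∧
      x ≠ y ∧ u'.length = v'.length ∧ wordHammingDist u' v' = n := by
  induction u generalizing v with
  | nil => simp [wordHammingDist] at h
  | cons l u ih =>
    cases v with
    | nil => simp at hl
    | cons m v =>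
      rw [wordHammingDist_cons] at h
      by_cases hlm : l = m
      · subst hlm
        obtain ⟨p, x, y, u', v', rfl, rfl, h1, h2, h3⟩ := ih (by simpa using hl) (by simpa using h)
        exact ⟨l :: p, x, y, u', v', rfl, rfl, h1, h2, h3⟩
      · exact ⟨[], l, m, u, v, rfl, rfl, hlm, by simpa using hl, by simpa [hlm] using h⟩

end Hamming

theorem MEquiv.wordHammingDist_ne_zero {u v : List (Fin 3)} (h : MEquiv u v) (hne : u ≠ v) :
    wordHammingDist u v ≠ 0 := fun h0 => hne (eq_of_wordHammingDist_eq_zero h.length_eq h0)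

theorem MEquiv.wordHammingDist_ne_one {u v : List (Fin 3)} (h : MEquiv u v) :
    wordHammingDist u v ≠ 1 := by
  intro h1
  obtain ⟨p, x, y, u', v', rfl, rfl, hxy, hl, h0⟩ := exists_split_of_wordHammingDist h.length_eq h1
  obtain rfl := eq_of_wordHammingDist_eq_zero hl h0
  obtain ⟨h0, h1, h2, -⟩ := mEquiv_iff.1 h
  revert hxy
  fin_cases x <;> fin_cases y <;> simp at h0 h1 h2 ⊢

theorem derangement_of_three : ∀ x y z x' y' z' : Fin 3, x ≠ x' → y ≠ y' → z ≠ z' →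
    (∀ l, [x, y, z].count l = [x', y', z'].count l) →
    (x ≠ y ∧ y ≠ z ∧ x ≠ z) ∧ ((x' = y ∧ y' = z ∧ z' = x) ∨ (x' = z ∧ y' = x ∧ z' = y)) := by
  decide

/-- Equal letter counts force the three differing positions to carry a, b, c permuted cyclically;
the ab- and bc-counts cannot both survive such a rotation. -/
theorem MEquiv.wordHammingDist_ne_three {u v : List (Fin 3)} (h : MEquiv u v) :
    wordHammingDist u v ≠ 3 := by
  intro h3
  obtain ⟨p, x, x', u, v, rfl, rfl, hx, hl, h2⟩ := exists_split_of_wordHammingDist h.length_eq h3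
  obtain ⟨q, y, y', u, v, rfl, rfl, hy, hl, h1⟩ := exists_split_of_wordHammingDist hl h2
  obtain ⟨r, z, z', u, v, rfl, rfl, hz, hl, h0⟩ := exists_split_of_wordHammingDist hl h1
  obtain rfl := eq_of_wordHammingDist_eq_zero hl h0
  obtain ⟨e0, e1, e2, e3, e4, -⟩ := mEquiv_iff.1 h
  have hc : ∀ l, [x, y, z].count l = [x', y', z'].count l := by
    intro l
    simp only [List.count_append, List.count_cons, List.count_nil] at e0 e1 e2 ⊢
    fin_cases l
    · simp only [Fin.zero_eta] at *; omega
    · simp only [Fin.mk_one] at *; omega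
    · simp only [Fin.reduceFinMk] at *; omega
  obtain ⟨⟨n1, n2, n3⟩, hd⟩ := derangement_of_three x y z x' y' z' hx hy hz hc
  simp only [abCount_append, bcCount_append, abCount, bcCount, List.count_append,
    List.count_cons] at e3 e4
  rcases hd with ⟨rfl, rfl, rfl⟩ | ⟨rfl, rfl, rfl⟩ <;> revert n1 n2 n3 <;> fin_cases x' <;>
    fin_cases y' <;> fin_cases z' <;> simp at e3 e4 ⊢ <;> ring_nf at e3 e4 <;> omega

/-! ### Rigid height multisets and the maximum principle -/

/-- Combinatorial constraints on the heights `A` of one outer letter (relative to the heights `C`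
of the other outer letter) in a word with `B` letters `b` whose `M`-class is sparse. -/
structure Rigid (B : ℕ) (A C : List ℕ) : Prop where
  le : ∀ i ∈ A, i ≤ B
  disj : ∀ i ∈ A, i ∉ C
  two : ∀ i, 2 ≤ A.count i → i = 0 ∨ i = B
  -- With no height of C between them, i and j could be moved one step apart unless one is at the
  -- boundary, and one step together if they were at least 2 apart.
  adj : ∀ i ∈ A, ∀ j ∈ A, i < j → (∀ k ∈ C, i < k → j ≤ k) → (i = 0 ∨ j = B) ∧ j ≤ i + 1
  left : ∀ x₁ ∈ A, ∀ x₂ ∈ A, ∀ x₃ ∈ A, x₁ < x₂ → x₂ < x₃ → (∀ k ∈ A, x₁ < k → x₂ ≤ k) →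
    (∀ k ∈ A, x₂ < k → x₃ ≤ k) → (∃ y ∈ C, x₁ < y ∧ y < x₂) → (∃ y ∈ C, x₂ < y ∧ y < x₃) →
    1 ≤ x₁ → x₃ = x₂ + 2
  right : ∀ x₁ ∈ A, ∀ x₂ ∈ A, ∀ x₃ ∈ A, x₁ < x₂ → x₂ < x₃ → (∀ k ∈ A, x₁ < k → x₂ ≤ k) →
    (∀ k ∈ A, x₂ < k → x₃ ≤ k) → (∃ y ∈ C, x₁ < y ∧ y < x₂) → (∃ y ∈ C, x₂ < y ∧ y < x₃) →
    x₃ < B → x₂ = x₁ + 2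

/-- The multiset `A'` of heights arises from `A` by adding the discrete Laplacian of `f`, a function
vanishing outside the open interval from `0` to `B`. -/
structure Transport (B : ℕ) (A A' : List ℕ) (f : ℕ → ℤ) : Prop where
  zero : f 0 = 0
  far : ∀ i, B ≤ i → f i = 0
  lap : ∀ i, (A'.count i : ℤ) = A.count i + f (i + 1) + f (i - 1) - 2 * f i

namespace Transport

variable {B : ℕ} {A A' C C' : List ℕ} {f g : ℕ → ℤ}

theorem neg (T : Transport B A A' f) : Transport B A' A (-f) :=
  ⟨by simp [T.zero], fun i hi => by simp [T.far i hi], fun i => by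
    have := T.lap i
    simp only [Pi.neg_apply]
    omega⟩

/-- Start at the leftmost maximum and follow the run of equal values; positivity keeps it strictly
between 0 and B. -/
theorem exists_plateau (T : Transport B A A' f) (h : ∃ i, 0 < f i) :
    ∃ s t, s ≤ t ∧ 1 ≤ s ∧ t < B ∧ 0 < f s ∧ (∀ i, s ≤ i → i ≤ t → f i = f s) ∧
      f (s - 1) < f s ∧ f (t + 1) < f s := by
  obtain ⟨i, hi⟩ := h
  obtain ⟨m, hm, hmax⟩ := Finset.exists_max_image (Finset.range (B + 1)) f ⟨0, by simp⟩
  have hle : ∀ k, f k ≤ max (f m) 0 := by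
    intro k
    by_cases hk : k < B + 1
    · exact le_max_of_le_left (hmax k (by simpa using hk))
    · rw [T.far k (by omega)]
      exact le_max_right _ _
  have hm0 : 0 < f m := by
    have := hle i
    by_contra hc
    rw [max_eq_right (by omega)] at this
    omega
  replace hle : ∀ k, f k ≤ f m := fun k => by simpa [max_eq_left hm0.le] using hle k
  classical
  have hex : ∃ s, f s = f m := ⟨m, rfl⟩
  set s := Nat.find hex with hs
  have hsm : f s = f m := Nat.find_spec hex
  have hlt : ∀ k, k < s → f k < f m := fun k hk =>
    lt_of_le_of_ne (hle k) (Nat.find_min hex hk)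
  have hs1 : 1 ≤ s := by
    rcases Nat.eq_zero_or_pos s with h0 | h0
    · rw [h0, T.zero] at hsm
      omega
    · exact h0
  have hsB : s < B := by
    by_contra hc
    rw [T.far s (by omega)] at hsm
    omega
  have hex2 : ∃ k, f (s + k + 1) ≠ f m := ⟨B, by rw [T.far _ (by omega)]; omega⟩
  set k := Nat.find hex2 with hk
  have hk1 : f (s + k + 1) ≠ f m := Nat.find_spec hex2
  have hk2 : ∀ j, j < k → f (s + j + 1) = f m := fun j hj => not_not.1 (Nat.find_min hex2 hj)
  have hpl : ∀ i, s ≤ i → i ≤ s + k → f i = f m := by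
    intro i h1 h2
    rcases Nat.eq_or_lt_of_le h1 with rfl | h1
    · exact hsm
    · have := hk2 (i - s - 1) (by omega)
      rwa [show s + (i - s - 1) + 1 = i by omega] at this
  refine ⟨s, s + k, by omega, hs1, ?_, by omega, fun i h1 h2 => by rw [hpl i h1 h2, hsm], ?_, ?_⟩
  · by_contra hc
    have := hpl (s + k) (by omega) le_rfl
    rw [T.far _ (by omega)] at this
    omega
  · rw [hsm]
    exact hlt _ (by omega)
  · rw [hsm]
    exact lt_of_le_of_ne (hle _) hk1

/-- The Laplacian is negative at both ends of a maximal plateau, so A loses a height there. A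
one-point plateau would lose two copies of an interior height, against `Rigid.two`; otherwise
`Rigid.adj` supplies an element of C inside. -/
theorem exists_peak (T : Transport B A A' f) (hA : Rigid B A C) (h : ∃ i, 0 < f i) :
    ∃ s t y, 1 ≤ s ∧ t < B ∧ s < y ∧ y < t ∧ s ∈ A ∧ t ∈ A ∧ y ∈ C ∧
      (∀ i, s ≤ i → i ≤ t → f i = f s) ∧ 0 < f s ∧ f (s - 1) < f s := by
  obtain ⟨s, t, hst, hs, ht, hpos, hpl, h1, h2⟩ := T.exists_plateau h
  have ls := T.lap s
  have lt := T.lap t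
  rcases Nat.eq_or_lt_of_le hst with rfl | hst'
  · have := hA.two s (by omega)
    omega
  · have e1 := hpl (s + 1) (by omega) (by omega)
    have e2 := hpl (t - 1) (by omega) (by omega)
    have e3 := hpl t (by omega) (by omega)
    have hsA : s ∈ A := List.count_pos_iff.1 (by omega)
    have htA : t ∈ A := List.count_pos_iff.1 (by omega)
    by_cases hy : ∃ y ∈ C, s < y ∧ y < t
    · obtain ⟨y, hy, h3, h4⟩ := hy
      exact ⟨s, t, y, hs, ht, h3, h4, hsA, htA, hy, hpl, hpos, h1⟩
    · push Not at hy
      have := hA.adj s hsA t htA hst' hy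
      omega

/-- Without heights of A below s, f is convex there; starting from f 0 = 0 it is nondecreasing,
hence nonnegative at s. The truncated value f (0 - 1) is f 0 and does no harm. -/
theorem exists_mem_lt (T : Transport B A A' f) {s : ℕ} (hs : f s < 0) : ∃ l ∈ A, l < s := by
  by_contra! hc
  have key : ∀ i, i ≤ s → f (i - 1) ≤ f i := by
    intro i
    induction i with
    | zero => simp
    | succ i ih =>
      intro hi
      have h1 := T.lap i
      have h2 : A.count i = 0 := List.count_eq_zero.2 fun h => by have := hc i h; omega
      have h3 := ih (by omega)
      simp only [Nat.add_sub_cancel]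
      omega
  have key2 : ∀ i, i ≤ s → 0 ≤ f i := by
    intro i
    induction i with
    | zero => simp [T.zero]
    | succ i ih =>
      intro hi
      have h1 := key (i + 1) hi
      have h2 := ih (by omega)
      simp only [Nat.add_sub_cancel] at h1
      omega
  have := key2 s le_rfl
  omega

theorem exists_mem_gt (T : Transport B A A' f) {s : ℕ} (hs : f s < 0) : ∃ r ∈ A, s < r := by
  by_contra! hc
  -- The mirrored convexity argument descends from s + B, where f already vanishes, to s.
  have key : ∀ k, f (s + (B - k) + 1) ≤ f (s + (B - k)) := by
    intro k
    induction k with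
    | zero =>
      rw [T.far _ (by omega), T.far _ (by omega)]
    | succ k ih =>
      by_cases hk : k < B
      · have h1 := T.lap (s + (B - k))
        have h2 : A.count (s + (B - k)) = 0 :=
          List.count_eq_zero.2 fun h => by have := hc _ h; omega
        rw [show s + (B - (k + 1)) + 1 = s + (B - k) by omega]
        rw [show s + (B - k) - 1 = s + (B - (k + 1)) by omega] at h1
        omega
      · rwa [show B - (k + 1) = B - k by omega]
  have key2 : ∀ k, 0 ≤ f (s + (B - k)) := by
    intro k
    induction k with
    | zero => rw [T.far _ (by omega)]
    | succ k ih =>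
      by_cases hk : k < B
      · have h1 := key (k + 1)
        rw [show s + (B - (k + 1)) + 1 = s + (B - k) by omega] at h1
        omega
      · rwa [show B - (k + 1) = B - k by omega]
  have := key2 B
  simp only [Nat.sub_self, Nat.add_zero] at this
  omega

end Transport

theorem exists_pred {A : List ℕ} {s : ℕ} (h : ∃ l ∈ A, l < s) :
    ∃ l ∈ A, l < s ∧ ∀ k ∈ A, l < k → s ≤ k := by
  classical
  obtain ⟨l₀, h₀, h₀'⟩ := h
  obtain ⟨l, hl, hmax⟩ := Finset.exists_max_image (A.toFinset.filter (· < s)) id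
    ⟨l₀, by simp [h₀, h₀']⟩
  simp only [Finset.mem_filter, List.mem_toFinset, id] at hl hmax
  refine ⟨l, hl.1, hl.2, fun k hk hlk => ?_⟩
  by_contra hc
  have := hmax k ⟨hk, by omega⟩
  omega

theorem exists_succ {A : List ℕ} {s : ℕ} (h : ∃ r ∈ A, s < r) :
    ∃ r ∈ A, s < r ∧ ∀ k ∈ A, s < k → r ≤ k := by
  classical
  obtain ⟨l₀, h₀, h₀'⟩ := h
  obtain ⟨l, hl, hmin⟩ := Finset.exists_min_image (A.toFinset.filter (s < ·)) id
    ⟨l₀, by simp [h₀, h₀']⟩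
  simp only [Finset.mem_filter, List.mem_toFinset, id] at hl hmin
  exact ⟨l, hl.1, hl.2, fun k hk hlk => hmin k ⟨hk, hlk⟩⟩

section

variable {B : ℕ} {A A' C C' : List ℕ} {f g : ℕ → ℤ}

theorem Rigid.exists_between (hA : Rigid B A C) {i j : ℕ} (hi : i ∈ A) (hj : j ∈ A) (hij : i < j)
    (h : (1 ≤ i ∧ j < B) ∨ i + 2 ≤ j) : ∃ y ∈ C, i < y ∧ y < j := by
  by_contra! hc
  have := hA.adj i hi j hj hij hc
  omega

/-- A minimum of f is a peak of -f, with plateau ends in A'. Neither the left end s nor s + 1 can be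
in A: the first would make s a double interior height of A', the second would put s and s + 1 both
in A'. So the neighbours of s in A are at least 3 apart. -/
theorem Transport.exists_valley (T : Transport B A A' f) (hA' : Rigid B A' C')
    (h : ∃ i, f i < 0) : ∃ l r s, l ∈ A ∧ r ∈ A ∧ l < s ∧ s < r ∧ l + 3 ≤ r ∧
      (∀ k ∈ A, l < k → r ≤ k) ∧ f s < 0 := by
  obtain ⟨s, t, y, hs, ht, hsy, hyt, hsA, htA, hyC, hpl, hpos, hlt⟩ :=
    T.neg.exists_peak hA' (by simpa using h)
  simp only [Pi.neg_apply, Left.neg_pos_iff, neg_lt_neg_iff, neg_inj] at hpl hpos hlt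
  obtain ⟨l, hlA, hls, hl⟩ := exists_pred (T.exists_mem_lt hpos)
  obtain ⟨r, hrA, hsr, hr⟩ := exists_succ (T.exists_mem_gt hpos)
  have h1 : s ∉ A := by
    intro hc
    have h1 := List.count_pos_iff.2 hc
    have h2 := T.lap s
    have h3 := hpl (s + 1) (by omega) (by omega)
    have := hA'.two s (by omega)
    omega
  have h2 : r ≠ s + 1 := by
    rintro rfl
    have h1 := List.count_pos_iff.2 hrA
    have h2 := T.lap (s + 1)
    simp only [Nat.add_sub_cancel] at h2
    have h3 := hpl (s + 1) (by omega) (by omega)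
    have h4 := hpl (s + 1 + 1) (by omega) (by omega)
    have h5 : s + 1 ∈ A' := List.count_pos_iff.1 (by omega)
    obtain ⟨z, -, hz⟩ := hA'.exists_between hsA h5 (by omega) (Or.inl (by omega))
    omega
  refine ⟨l, r, s, hlA, hrA, hls, hsr, by omega, fun k hk hlk => hr k hk ?_, hpos⟩
  have := hl k hk hlk
  rcases Nat.eq_or_lt_of_le this with rfl | h
  · exact absurd hk h1
  · exact h

/-- A valley gap l, r of length at least 3 lies to one side of a peak plateau. The next element of A
on the side of the plateau is interior, so `Rigid.right` or `Rigid.left` makes that gap 2. -/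
theorem Transport.nonneg_or_nonpos (T : Transport B A A' f) (hA : Rigid B A C)
    (hA' : Rigid B A' C') : (∀ i, 0 ≤ f i) ∨ (∀ i, f i ≤ 0) := by
  by_contra! hc
  obtain ⟨hneg, hpos⟩ := hc
  obtain ⟨s, t, y, hs, ht, hsy, hyt, hsA, htA, hyC, hpl, hfs, -⟩ := T.exists_peak hA hpos
  obtain ⟨l, r, v, hlA, hrA, hlv, hvr, hlr, hcons, hv⟩ := T.exists_valley hA' hneg
  have hvst : v < s ∨ t < v := by
    by_contra! hc
    have := hpl v hc.1 hc.2
    omega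
  have hbt := hA.exists_between hlA hrA (by omega) (Or.inr (by omega))
  rcases hvst with hvs | hvt
  · have hrs := hcons s hsA (by omega)
    obtain ⟨z, hzA, hrz, hz⟩ := exists_succ (A := A) (s := r) ⟨t, htA, by omega⟩
    have hzt := hz t htA (by omega)
    have := hA.right l hlA r hrA z hzA (by omega) hrz hcons hz hbt
      (hA.exists_between hrA hzA hrz (Or.inl (by omega))) (by omega)
    omega
  · have htl : t ≤ l := by
      by_contra hc
      have := hcons t htA (by omega)
      omega
    obtain ⟨z, hzA, hzl, hz⟩ := exists_pred (A := A) (s := l) ⟨s, hsA, by omega⟩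
    have hsz : s ≤ z := by
      by_contra hc
      have := hz s hsA (by omega)
      omega
    have := hA.left z hzA l hlA r hrA hzl (by omega) hz hcons
      (hA.exists_between hzA hlA hzl (Or.inl (by have := hA.le r hrA; omega))) hbt (by omega)
    omega

/-- All terms of the two identities are nonnegative, so f vanishes on C and g on A, but a peak of f
contains an element of C and a peak of g one of A. -/
theorem Transport.eq_zero_of_nonneg (Tf : Transport B A A' f) (Tg : Transport B C C' g)
    (hA : Rigid B A C) (hC : Rigid B C A) (e₁ : (C'.map f).sum + (A.map g).sum = 0)
    (e₂ : (C.map f).sum + (A'.map g).sum = 0) (hf : ∀ i, 0 ≤ f i) (hg : ∀ i, 0 ≤ g i) :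
    (∀ i, f i = 0) ∧ ∀ i, g i = 0 := by
  have nn : ∀ (D : List ℕ) (h : ℕ → ℤ), (∀ i, 0 ≤ h i) → 0 ≤ (D.map h).sum := by
    intro D h hh
    exact List.sum_nonneg (by simpa using fun i _ => hh i)
  have le : ∀ (D : List ℕ) (h : ℕ → ℤ), (∀ i, 0 ≤ h i) → ∀ y ∈ D, h y ≤ (D.map h).sum := by
    intro D h hh y hy
    exact List.single_le_sum (by simpa using fun i _ => hh i) _ (List.mem_map_of_mem hy)
  constructor
  · by_contra! hc
    obtain ⟨i, hi⟩ := hc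
    obtain ⟨s, t, y, hs, ht, hsy, hyt, hsA, htA, hyC, hpl, hfs, -⟩ :=
      Tf.exists_peak hA ⟨i, lt_of_le_of_ne (hf i) (Ne.symm hi)⟩
    have h1 := le C f hf y hyC
    have h2 := hpl y (by omega) (by omega)
    have h3 := nn A' g hg
    omega
  · by_contra! hc
    obtain ⟨i, hi⟩ := hc
    obtain ⟨s, t, y, hs, ht, hsy, hyt, hsA, htA, hyC, hpl, hfs, -⟩ :=
      Tg.exists_peak hC ⟨i, lt_of_le_of_ne (hg i) (Ne.symm hi)⟩
    have h1 := le A g hg y hyC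
    have h2 := hpl y (by omega) (by omega)
    have h3 := nn C' f hf
    omega

theorem List.length_eq_two_of_count {A : List ℕ} {x z : ℕ} (hxz : x ≠ z)
    (h : ∀ k ∈ A, k = x ∨ k = z) (hx : A.count x = 1) (hz : A.count z = 1) : A.length = 2 := by
  have key : ∀ A : List ℕ, (∀ k ∈ A, k = x ∨ k = z) → A.length = A.count x + A.count z := by
    intro A
    induction A with
    | nil => simp
    | cons a A ih =>
      intro h
      have h1 := ih fun k hk => h k (List.mem_cons_of_mem _ hk)
      rcases h a (by simp) with rfl | rfl
      · simp [h1, hxz]; omega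
      · simp [h1, hxz.symm]; omega
  rw [key A h, hx, hz]

/-- Since f is nonnegative, boundary heights of A would persist in A'; so A is simple and interior,
with an element of C between any two of its elements. The valley of g is a gap p, q of length at
least 3 in C containing exactly one x in A. Neighbours of x in A on both sides would be x - 2 and x
+ 2, making the gap 2; a third element beyond the neighbour z would make it 2 through the rigidity
of C. -/
theorem Transport.length_eq_two (Tf : Transport B A A' f) (Tg : Transport B C C' g)
    (hA : Rigid B A C) (hC : Rigid B C A) (hC' : Rigid B C' A')
    (hf : ∀ i, 0 ≤ f i) (hf0 : ∃ i, f i ≠ 0) (hg0 : ∃ i, g i < 0)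
    (h0 : 0 ∈ A → 0 ∉ A') (hB : B ∈ A → B ∉ A') :
    A.length = 2 ∧ ∃ p ∈ C, ∃ q ∈ C, ∃ x ∈ A, ∃ z ∈ A, p < x ∧ x < q ∧ (q < z ∨ z < p) := by
  have hA0 : ∀ i ∈ A, 1 ≤ i := by
    intro i hi
    by_contra hc
    obtain rfl : i = 0 := by omega
    have h1 := List.count_pos_iff.2 hi
    have h2 := Tf.lap 0
    have h3 := hf 1
    have h4 := Tf.zero
    simp only [Nat.zero_add, Nat.zero_sub] at h2
    exact h0 hi (List.count_pos_iff.1 (by omega))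
  have hAB : ∀ i ∈ A, i < B := by
    intro i hi
    by_contra hc
    obtain rfl : i = B := by have := hA.le i hi; omega
    have h1 := List.count_pos_iff.2 hi
    have h2 := Tf.lap i
    have h3 := hf (i - 1)
    have h4 := Tf.far i le_rfl
    have h5 := Tf.far (i + 1) (by omega)
    exact hB hi (List.count_pos_iff.1 (by omega))
  have cnt : ∀ i ∈ A, A.count i = 1 := by
    intro i hi
    have h1 := List.count_pos_iff.2 hi
    have h2 := hA.two i
    have h3 := hA0 i hi
    have h4 := hAB i hi
    omega
  have btw : ∀ i ∈ A, ∀ j ∈ A, i < j → ∃ y ∈ C, i < y ∧ y < j := fun i hi j hj hij =>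
    hA.exists_between hi hj hij (Or.inl ⟨hA0 i hi, hAB j hj⟩)
  obtain ⟨p, q, -, hpC, hqC, -, -, hpq, hcons, -⟩ := Tg.exists_valley hC' hg0
  obtain ⟨x, hxA, hpx, hxq⟩ := hC.exists_between hpC hqC (by omega) (Or.inr (by omega))
  have hx : ∀ k ∈ A, p < k → k < q → k = x := by
    intro k hk hpk hkq
    by_contra hne
    rcases Nat.lt_or_gt_of_ne hne with h | h
    · obtain ⟨y, hy, h1, h2⟩ := btw k hk x hxA h
      have := hcons y hy (by omega)
      omega
    · obtain ⟨y, hy, h1, h2⟩ := btw x hxA k hk h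
      have := hcons y hy (by omega)
      omega
  have hne : ∀ k ∈ A, k ≠ p ∧ k ≠ q := fun k hk =>
    ⟨fun h => hA.disj k hk (h ▸ hpC), fun h => hA.disj k hk (h ▸ hqC)⟩
  have hside : ∀ k ∈ A, k = x ∨ k < p ∨ q < k := by
    intro k hk
    have h1 := hne k hk
    have h2 := hx k hk
    omega
  have hnext : ∀ k ∈ A, x < k → q < k := fun k hk h => by have := hside k hk; omega
  have hprev : ∀ k ∈ A, k < x → k < p := fun k hk h => by have := hside k hk; omega
  -- `x` is the first or the last element of `A`
  have hext : ¬ ((∃ k ∈ A, k < x) ∧ ∃ k ∈ A, x < k) := by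
    rintro ⟨h1, h2⟩
    obtain ⟨k, hk, hkx, hk'⟩ := exists_pred h1
    obtain ⟨m, hm, hxm, hm'⟩ := exists_succ h2
    have e1 := hA.left k hk x hxA m hm hkx hxm hk' hm' (btw _ hk _ hxA hkx) (btw _ hxA _ hm hxm)
      (hA0 k hk)
    have e2 := hA.right k hk x hxA m hm hkx hxm hk' hm' (btw _ hk _ hxA hkx) (btw _ hxA _ hm hxm)
      (hAB m hm)
    have := hprev k hk hkx
    have := hnext m hm hxm
    omega
  obtain ⟨s, t, y, -, -, hsy, hyt, hsA, htA, -⟩ :=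
    Tf.exists_peak hA (hf0.imp fun i hi => lt_of_le_of_ne (hf i) (Ne.symm hi))
  have hst : s < t := by omega
  have hcase : (∃ k ∈ A, x < k) ∨ ∃ k ∈ A, k < x := by
    rcases Nat.lt_trichotomy t x with h | h | h
    · exact Or.inr ⟨t, htA, h⟩
    · exact Or.inr ⟨s, hsA, by omega⟩
    · exact Or.inl ⟨t, htA, h⟩
  rcases hcase with h | h
  · obtain ⟨z, hz, hxz, hz'⟩ := exists_succ h
    have hqz := hnext z hz hxz
    have hlast : ¬ ∃ k ∈ A, z < k := by
      intro hk
      obtain ⟨m, hm, hzm, hm'⟩ := exists_succ hk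
      have e1 := hA.left x hxA z hz m hm hxz hzm hz' hm' (btw _ hxA _ hz hxz) (btw _ hz _ hm hzm)
        (hA0 x hxA)
      have e2 := hA.right x hxA z hz m hm hxz hzm hz' hm' (btw _ hxA _ hz hxz)
        (btw _ hz _ hm hzm) (hAB m hm)
      obtain ⟨y, hy, hzy, hym⟩ := btw _ hz _ hm hzm
      obtain ⟨q', hq', hqq', hq''⟩ := exists_succ (A := C) (s := q) ⟨y, hy, by omega⟩
      have hq'y := hq'' y hy (by omega)
      -- Here q = x + 1 and z = x + 2, so the next element of C after q lies beyond z, and q = p + 2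
      -- follows, against the gap of at least 3.
      have := hC.right p hpC q hqC q' hq' (by omega) hqq' hcons hq'' ⟨x, hxA, hpx, hxq⟩
        ⟨z, hz, hqz, by
          by_contra hc
          have h1 := hA.disj z hz
          have h2 : q' ≠ z := fun h => h1 (h ▸ hq')
          omega⟩ (by have := hAB m hm; omega)
      omega
    refine ⟨List.length_eq_two_of_count (x := x) (z := z) (by omega) ?_ (cnt x hxA) (cnt z hz),
      p, hpC, q, hqC, x, hxA, z, hz, hpx, hxq, Or.inl hqz⟩
    intro k hk
    by_contra! hc
    rcases Nat.lt_or_gt_of_ne hc.1 with h1 | h1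
    · exact hext ⟨⟨k, hk, h1⟩, z, hz, hxz⟩
    · have h2 := hz' k hk h1
      exact hlast ⟨k, hk, by omega⟩
  · obtain ⟨z, hz, hxz, hz'⟩ := exists_pred h
    have hqz := hprev z hz hxz
    have hlast : ¬ ∃ k ∈ A, k < z := by
      intro hk
      obtain ⟨m, hm, hzm, hm'⟩ := exists_pred hk
      have e1 := hA.left m hm z hz x hxA hzm hxz hm' hz' (btw _ hm _ hz hzm) (btw _ hz _ hxA hxz)
        (hA0 m hm)
      have e2 := hA.right m hm z hz x hxA hzm hxz hm' hz' (btw _ hm _ hz hzm)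
        (btw _ hz _ hxA hxz) (hAB x hxA)
      obtain ⟨y, hy, hzy, hym⟩ := btw _ hm _ hz hzm
      obtain ⟨q', hq', hqq', hq''⟩ := exists_pred (A := C) (s := p) ⟨y, hy, by omega⟩
      have hq'y : y ≤ q' := by
        by_contra hc
        have := hq'' y hy (by omega)
        omega
      have := hC.left q' hq' p hpC q hqC hqq' (by omega) hq'' hcons
        ⟨z, hz, by
          by_contra hc
          have h1 := hA.disj z hz
          have h2 : q' ≠ z := fun h => h1 (h ▸ hq')
          omega, hqz⟩ ⟨x, hxA, hpx, hxq⟩ (by have := hA0 m hm; omega)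
      omega
    refine ⟨List.length_eq_two_of_count (x := x) (z := z) (by omega) ?_ (cnt x hxA) (cnt z hz),
      p, hpC, q, hqC, x, hxA, z, hz, hpx, hxq, Or.inr hqz⟩
    intro k hk
    by_contra! hc
    rcases Nat.lt_or_gt_of_ne hc.1 with h1 | h1
    · by_cases h2 : k < z
      · exact hlast ⟨k, hk, h2⟩
      · have := hz' k hk (by omega)
        omega
    · exact hext ⟨⟨z, hz, hxz⟩, k, hk, h1⟩

end

/-! ### Heights of outer letters and the counts ab, bc -/

/-- The heights of the occurrences of the letter `x` in a word: for each of them, the number of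
letters `b` to its left. -/
def heights (x : Fin 3) : List (Fin 3) → List ℕ
  | [] => []
  | l :: w => if l = 1 then (heights x w).map (· + 1) else
      if l = x then 0 :: heights x w else heights x w

section heights

variable {x : Fin 3}

theorem heights_one_cons (w : List (Fin 3)) :
    heights x (1 :: w) = (heights x w).map (· + 1) := by simp [heights]

theorem heights_self_cons (hx : x ≠ 1) (w : List (Fin 3)) :
    heights x (x :: w) = 0 :: heights x w := by simp [heights, hx]

theorem heights_cons_of_ne {y : Fin 3} (hy : y ≠ 1) (hxy : y ≠ x) (w : List (Fin 3)) :
    heights x (y :: w) = heights x w := by simp [heights, hy, hxy]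

theorem heights_append (u v : List (Fin 3)) :
    heights x (u ++ v) = heights x u ++ (heights x v).map (· + u.count 1) := by
  induction u with
  | nil => simp [heights]
  | cons l u ih =>
    by_cases h1 : l = 1
    · subst h1
      simp only [List.cons_append, heights_one_cons, ih, List.map_append, List.map_map,
        List.count_cons_self]
      rfl
    · by_cases h2 : l = x
      · subst h2
        simp [heights, h1, ih]
      · simp [heights, h1, h2, ih]

theorem length_heights (hx : x ≠ 1) (w : List (Fin 3)) : (heights x w).length = w.count x := by
  induction w with
  | nil => rfl
  | cons l w ih =>
    by_cases h1 : l = 1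
    · subst h1
      simp [heights, ih, hx.symm]
    · by_cases h2 : l = x
      · subst h2
        simp [heights, h1, ih]
      · simp [heights, h1, h2, ih]

theorem le_of_mem_heights {w : List (Fin 3)} {i : ℕ} (h : i ∈ heights x w) : i ≤ w.count 1 := by
  induction w generalizing i with
  | nil => simp [heights] at h
  | cons l w ih =>
    by_cases h1 : l = 1
    · subst h1
      simp only [heights_one_cons, List.mem_map] at h
      obtain ⟨j, hj, rfl⟩ := h
      simpa using ih hj
    · rw [List.count_cons_of_ne h1]
      by_cases h2 : l = x
      · subst h2
        rw [heights_self_cons h1] at h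
        rcases List.mem_cons.1 h with rfl | h
        · omega
        · exact ih h
      · simp only [heights, h1, h2, if_false] at h
        exact ih h

theorem exists_split_first (hx : x ≠ 1) {w : List (Fin 3)} {i : ℕ} (h : i ∈ heights x w) :
    ∃ p r, w = p ++ x :: r ∧ p.count 1 = i ∧ i ∉ heights x p := by
  induction w generalizing i with
  | nil => simp [heights] at h
  | cons l w ih =>
    by_cases h1 : l = 1
    · subst h1
      simp only [heights_one_cons, List.mem_map] at h
      obtain ⟨j, hj, rfl⟩ := h
      obtain ⟨p, r, rfl, h2, h3⟩ := ih hj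
      exact ⟨1 :: p, r, rfl, by simp [h2], by simpa [heights_one_cons] using h3⟩
    · by_cases h2 : l = x
      · subst h2
        rw [heights_self_cons hx] at h
        by_cases hi : i = 0
        · subst hi
          exact ⟨[], w, rfl, rfl, by simp [heights]⟩
        · obtain ⟨p, r, rfl, h2, h3⟩ := ih (by simpa [hi] using h)
          exact ⟨l :: p, r, rfl, by simp [h2, hx], by simp [heights_self_cons hx, h3, hi]⟩
      · rw [heights_cons_of_ne h1 h2] at h
        obtain ⟨p, r, rfl, h4, h5⟩ := ih h
        exact ⟨l :: p, r, rfl, by simp [h4, h1], by rwa [heights_cons_of_ne h1 h2]⟩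

theorem exists_split_last (hx : x ≠ 1) {w : List (Fin 3)} {i : ℕ} (h : i ∈ heights x w) :
    ∃ p r, w = p ++ x :: r ∧ p.count 1 = i ∧ 0 ∉ heights x r := by
  induction w generalizing i with
  | nil => simp [heights] at h
  | cons l w ih =>
    by_cases h1 : l = 1
    · subst h1
      simp only [heights_one_cons, List.mem_map] at h
      obtain ⟨j, hj, rfl⟩ := h
      obtain ⟨p, r, rfl, h2, h3⟩ := ih hj
      exact ⟨1 :: p, r, rfl, by simp [h2], h3⟩
    · by_cases hi : i ∈ heights x w
      · obtain ⟨p, r, rfl, h4, h5⟩ := ih hi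
        exact ⟨l :: p, r, rfl, by simp [h4, h1], h5⟩
      · by_cases h2 : l = x
        · subst h2
          rw [heights_self_cons hx] at h
          obtain rfl : i = 0 := by
            rcases List.mem_cons.1 h with h | h
            · exact h
            · exact absurd h hi
          exact ⟨[], w, rfl, rfl, hi⟩
        · rw [heights_cons_of_ne h1 h2] at h
          exact absurd h hi

theorem abCount_add_sum_heights (w : List (Fin 3)) :
    abCount w + (heights 0 w).sum = w.count 1 * w.count 0 := by
  induction w with
  | nil => rfl
  | cons l w ih =>
    have := length_heights (x := 0) (by decide) w
    fin_cases l
    · simp [abCount, heights, mul_add]; omega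
    · simp [abCount, heights, add_mul, List.sum_map_add, this]; omega
    · simpa [abCount, heights] using ih

theorem bcCount_eq_sum_heights (w : List (Fin 3)) : bcCount w = (heights 2 w).sum := by
  induction w with
  | nil => rfl
  | cons l w ih =>
    have := length_heights (x := 2) (by decide) w
    fin_cases l
    · simp [bcCount, heights, ih]
    · simp [bcCount, heights, List.sum_map_add, this, ih]; omega
    · simp [bcCount, heights, ih]

end heights

/-! ### Ramps: the transport functions and the abc-count -/

/-- The sum of the positive parts of the numbers `i - h` over the elements `h` of `A`. -/
def ramp (A : List ℕ) (i : ℕ) : ℕ := (A.map (i - ·)).sum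

theorem ramp_cons (h : ℕ) (A : List ℕ) (i : ℕ) : ramp (h :: A) i = (i - h) + ramp A i := by
  simp [ramp]

theorem ramp_zero (A : List ℕ) : ramp A 0 = 0 := by simp [ramp]

theorem ramp_laplacian (A : List ℕ) (i : ℕ) :
    ramp A (i + 1) + ramp A (i - 1) = 2 * ramp A i + A.count i := by
  induction A with
  | nil => simp [ramp]
  | cons h A ih =>
    simp only [ramp_cons, List.count_cons]
    by_cases hi : h = i
    · simp [hi]; omega
    · simp [hi]; omega

theorem ramp_add_sum {A : List ℕ} {i : ℕ} (h : ∀ k ∈ A, k ≤ i) :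
    ramp A i + A.sum = i * A.length := by
  induction A with
  | nil => simp [ramp]
  | cons k A ih =>
    have h1 := h k (by simp)
    have h2 := ih fun k hk => h k (List.mem_cons_of_mem _ hk)
    simp only [ramp_cons, List.sum_cons, List.length_cons, mul_add]
    omega

theorem ramp_map_succ (A : List ℕ) (i : ℕ) : ramp (A.map (· + 1)) (i + 1) = ramp A i := by
  simp only [ramp, List.map_map]
  congr 2
  ext k
  simp

/-- Above all heights a ramp is linear and determined by the size and sum of the multiset, so the
difference vanishes from B on. -/
theorem ramp_transport {B : ℕ} {A A' : List ℕ} (hA : ∀ k ∈ A, k ≤ B) (hA' : ∀ k ∈ A', k ≤ B)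
    (hl : A.length = A'.length) (hs : A.sum = A'.sum) :
    Transport B A A' fun i => (ramp A' i : ℤ) - ramp A i where
  zero := by simp [ramp_zero]
  far i hi := by
    have h1 := ramp_add_sum fun k hk => (hA k hk).trans hi
    have h2 := ramp_add_sum fun k hk => (hA' k hk).trans hi
    rw [hl] at h1
    omega
  lap i := by
    have h1 := ramp_laplacian A i
    have h2 := ramp_laplacian A' i
    omega

/-- An a at height h and a c at height k enclose k - h letters b; truncation gives 0 when the c
comes first. -/
theorem abcCount_eq_sum_ramp (w : List (Fin 3)) :
    abcCount w = ((heights 2 w).map (ramp (heights 0 w))).sum := by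
  induction w with
  | nil => rfl
  | cons l w ih =>
    fin_cases l
    · have : ∀ C : List ℕ, (C.map (ramp (0 :: heights 0 w))).sum =
          C.sum + (C.map (ramp (heights 0 w))).sum := by
        intro C
        induction C with
        | nil => rfl
        | cons c C ihC => simp [ihC, ramp_cons]; omega
      simp [abcCount, heights, ih, this, bcCount_eq_sum_heights]
    · have : ∀ C : List ℕ, ((C.map (· + 1)).map (ramp ((heights 0 w).map (· + 1)))).sum =
          (C.map (ramp (heights 0 w))).sum := by
        intro C
        rw [List.map_map]
        congr 2
        ext k
        exact ramp_map_succ _ _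
      simp only [Fin.mk_one, abcCount, heights_one_cons, this, ih]
      simp
    · simp [abcCount, heights, ih, ramp_zero]

/-- Interchanging the roles of the two lists in a sum of ramps. -/
theorem sum_ramp_comm (A C : List ℕ) : ((C.map (ramp A)).sum : ℤ) - (A.map (ramp C)).sum =
    A.length * C.sum - C.length * A.sum := by
  have key : ∀ (a : ℕ) (C : List ℕ), ((C.map (· - a)).sum : ℤ) - ramp C a = C.sum - C.length * a := by
    intro a C
    induction C with
    | nil => simp [ramp]
    | cons c C ih =>
      simp only [List.map_cons, List.sum_cons, ramp_cons, List.length_cons]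
      simp only [Nat.cast_add, Nat.cast_one]
      have : ((c - a : ℕ) : ℤ) - (a - c : ℕ) = c - a := by omega
      linarith
  induction A with
  | nil =>
    have : (C.map (ramp [])).sum = 0 := by
      induction C with
      | nil => rfl
      | cons c C ih => simp [ih]; simp [ramp]
    simp [this]
  | cons a A ih =>
    have h1 : (C.map (ramp (a :: A))).sum = (C.map (· - a)).sum + (C.map (ramp A)).sum := by
      have : ramp (a :: A) = fun i => (i - a) + ramp A i := funext (ramp_cons a A)
      rw [this, List.sum_map_add]
    have := key a C
    rw [h1]
    simp only [List.map_cons, List.sum_cons, List.length_cons]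
    simp only [Nat.cast_add, Nat.cast_one]
    linarith

theorem cast_sum_map_sub (A : List ℕ) (F G : ℕ → ℕ) :
    (A.map fun i => (F i : ℤ) - G i).sum = ((A.map F).sum : ℤ) - (A.map G).sum := by
  induction A with
  | nil => simp
  | cons a A ih => simp [ih]; ring

/-- Split the change of the double sum into changing A against C' and changing C against A.
`sum_ramp_comm` turns the latter into a sum over A, its correction depending only on sizes and sums.
-/
theorem sum_ramp_sub_eq_zero {A A' C C' : List ℕ} (hl' : C.length = C'.length) (hs' : C.sum = C'.sum)
    (h : (C.map (ramp A)).sum = (C'.map (ramp A')).sum) :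
    (C'.map fun i => (ramp A' i : ℤ) - ramp A i).sum +
      (A.map fun i => (ramp C' i : ℤ) - ramp C i).sum = 0 := by
  rw [cast_sum_map_sub, cast_sum_map_sub]
  have h1 := sum_ramp_comm A C
  have h2 := sum_ramp_comm A C'
  rw [← hl', ← hs'] at h2
  have h3 : ((C.map (ramp A)).sum : ℤ) = (C'.map (ramp A')).sum := by exact_mod_cast h
  linarith

theorem MEquiv.sum_heights_zero {u v : List (Fin 3)} (h : MEquiv u v) :
    (heights 0 u).sum = (heights 0 v).sum := by
  obtain ⟨h0, h1, h2, h3, h4, h5⟩ := mEquiv_iff.1 h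
  have e1 := abCount_add_sum_heights u
  have e2 := abCount_add_sum_heights v
  rw [h0, h1] at e1
  omega

theorem MEquiv.sum_heights_two {u v : List (Fin 3)} (h : MEquiv u v) :
    (heights 2 u).sum = (heights 2 v).sum := by
  obtain ⟨h0, h1, h2, h3, h4, h5⟩ := mEquiv_iff.1 h
  rw [← bcCount_eq_sum_heights, ← bcCount_eq_sum_heights, h4]

theorem MEquiv.length_heights {u v : List (Fin 3)} (h : MEquiv u v) {x : Fin 3} (hx : x ≠ 1) :
    (heights x u).length = (heights x v).length := by
  rw [_root_.length_heights hx, _root_.length_heights hx]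
  obtain ⟨h0, h1, h2, -⟩ := mEquiv_iff.1 h
  fin_cases x
  · exact h0
  · exact absurd rfl hx
  · exact h2

/-! ### Local moves and what sparseness forbids -/

/-- All distinct words of the `M`-class of `w` have Hamming distance greater than `4`. -/
def Sparse (w : List (Fin 3)) : Prop :=
  ∀ u v, MEquiv w u → MEquiv w v → u ≠ v → 4 < wordHammingDist u v

/-- The letters `x` and `y` are the two outer letters of the alphabet, in some order. -/
structure OuterPair (x y : Fin 3) : Prop where
  left : x ≠ 1
  right : y ≠ 1
  ne : x ≠ y

namespace OuterPair

variable {x y : Fin 3}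

theorem symm (h : OuterPair x y) : OuterPair y x := ⟨h.right, h.left, h.ne.symm⟩

theorem cases (h : OuterPair x y) : (x = 0 ∧ y = 2) ∨ (x = 2 ∧ y = 0) := by
  obtain ⟨h1, h2, h3⟩ := h
  revert h1 h2 h3
  fin_cases x <;> fin_cases y <;> simp

theorem eq_or (h : OuterPair x y) (l : Fin 3) : l = 1 ∨ l = x ∨ l = y := by
  rcases h.cases with ⟨rfl, rfl⟩ | ⟨rfl, rfl⟩ <;> fin_cases l <;> simp

theorem eq_replicate (h : OuterPair x y) {p : List (Fin 3)} (h1 : 1 ∉ p) (hy : y ∉ p) :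
    p = List.replicate p.length x := by
  rw [List.eq_replicate_iff]
  refine ⟨rfl, fun l hl => ?_⟩
  rcases h.eq_or l with rfl | rfl | rfl
  · exact absurd hl h1
  · rfl
  · exact absurd hl hy

theorem eq_replicate_one (h : OuterPair x y) {p : List (Fin 3)} (hx : x ∉ p) (hy : y ∉ p) :
    p = List.replicate p.length 1 := by
  rw [List.eq_replicate_iff]
  refine ⟨rfl, fun l hl => ?_⟩
  rcases h.eq_or l with rfl | rfl | rfl
  · rfl
  · exact absurd hl hx
  · exact absurd hl hy

theorem mEquiv_swap (h : OuterPair x y) : MEquiv [x, y] [y, x] := by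
  rw [mEquiv_iff]
  rcases h.cases with ⟨rfl, rfl⟩ | ⟨rfl, rfl⟩ <;> simp [abCount, bcCount, abcCount]

/-- One x goes up and one goes down, so the sum of heights is kept; with no y between them, the two
changes of the abc-count cancel. -/
theorem mEquiv_flip (h : OuterPair x y) {q : List (Fin 3)} (hq : y ∉ q) :
    MEquiv ([1, x] ++ q ++ [x, 1]) ([x, 1] ++ q ++ [1, x]) := by
  rw [mEquiv_iff]
  simp only [abCount_append, bcCount_append, abcCount_append, List.count_append]
  rcases h.cases with ⟨rfl, rfl⟩ | ⟨rfl, rfl⟩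
  · simp [abCount, bcCount, abcCount, abcCount_eq_zero (Or.inr hq), bcCount_eq_zero hq,
      List.count_eq_zero.2 hq]
    omega
  · simp [abCount, bcCount, abcCount, abcCount_eq_zero (Or.inl hq), abCount_eq_zero hq,
      List.count_eq_zero.2 hq]
    omega

end OuterPair

/-- The word in which the letters `x`, `y`, `x`, `y`, `x` are separated by powers of `b`. -/
def zigzag (x y : Fin 3) (p q r s : ℕ) : List (Fin 3) :=
  x :: (List.replicate p 1 ++ y :: (List.replicate q 1 ++ x :: (List.replicate r 1 ++
    y :: (List.replicate s 1 ++ [x]))))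

namespace OuterPair

variable {x y : Fin 3}

/-- The last two x's move together around the second y while the y's move apart around the middle x;
the effects on abc cancel. -/
theorem mEquiv_zigzag_left (h : OuterPair x y) (p q r s : ℕ) :
    MEquiv (zigzag x y (p + 1) q r (s + 2)) (zigzag x y p (q + 2) r s ++ [1]) := by
  rw [mEquiv_iff]
  rcases h.cases with ⟨rfl, rfl⟩ | ⟨rfl, rfl⟩ <;>
  · simp [zigzag, abCount, bcCount, abcCount, abCount_append, bcCount_append, abcCount_append,
      abCount_replicate_one, bcCount_replicate_one, abcCount_replicate_one, List.count_replicate]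
    omega

theorem mEquiv_zigzag_right (h : OuterPair x y) (p q r s : ℕ) :
    MEquiv (zigzag x y (p + 2) q r (s + 1)) (1 :: zigzag x y p q (r + 2) s) := by
  rw [mEquiv_iff]
  rcases h.cases with ⟨rfl, rfl⟩ | ⟨rfl, rfl⟩ <;>
  · simp [zigzag, abCount, bcCount, abcCount, abCount_append, bcCount_append, abcCount_append,
      abCount_replicate_one, bcCount_replicate_one, abcCount_replicate_one, List.count_replicate]
    omega

/-- The y's stay in place; the heights of the x's change by -1, +2, -1, an outward move around one y
and an inward move around the other. -/
theorem mEquiv_zigzag_shift (h : OuterPair x y) (p q r s : ℕ) :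
    MEquiv (1 :: zigzag x y p q (r + 2) (s + 1)) (zigzag x y (p + 1) (q + 2) r s ++ [1]) := by
  rw [mEquiv_iff]
  rcases h.cases with ⟨rfl, rfl⟩ | ⟨rfl, rfl⟩ <;>
  · simp [zigzag, abCount, bcCount, abcCount, abCount_append, bcCount_append, abcCount_append,
      abCount_replicate_one, bcCount_replicate_one, abcCount_replicate_one, List.count_replicate]
    omega

end OuterPair

namespace Sparse

variable {x y : Fin 3} {w u : List (Fin 3)}

theorem of_mEquiv (hw : Sparse w) (h : MEquiv w u) : Sparse u :=
  fun a b ha hb => hw a b (h.trans ha) (h.trans hb)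

theorem replace {p v q : List (Fin 3)} (hw : Sparse (p ++ u ++ q)) (h : MEquiv u v) :
    Sparse (p ++ v ++ q) := hw.of_mEquiv (h.context p q)

theorem of_cons {l : Fin 3} (hw : Sparse (l :: w)) : Sparse w := by
  intro u v hu hv hne
  have h1 : ∀ u, MEquiv w u → MEquiv (l :: w) (l :: u) := fun u h => by
    simpa using h.context [l] []
  simpa [wordHammingDist_cons] using hw _ _ (h1 u hu) (h1 v hv) (by simpa using hne)

theorem of_concat {l : Fin 3} (hw : Sparse (w ++ [l])) : Sparse w := by
  intro u v hu hv hne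
  have h1 : ∀ u, MEquiv w u → MEquiv (w ++ [l]) (u ++ [l]) := fun u h => by
    simpa using h.context [] [l]
  have := hw _ _ (h1 u hu) (h1 v hv) (by simpa using hne)
  rwa [wordHammingDist_append (hu.symm.trans hv).length_eq, wordHammingDist_self] at this

theorem not_of_replace {p v q : List (Fin 3)} (hw : Sparse (p ++ u ++ q)) (h : MEquiv u v)
    (hne : u ≠ v) (hd : wordHammingDist u v ≤ 4) : False := by
  have := hw _ _ rfl (h.context p q) (by simpa using hne)
  rw [wordHammingDist_append (by simp [h.length_eq]), wordHammingDist_append rfl,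
    wordHammingDist_self, wordHammingDist_self] at this
  omega

theorem not_adjacent (h : OuterPair x y) {p q : List (Fin 3)} (hw : Sparse (p ++ x :: y :: q)) :
    False := by
  have : Sparse (p ++ [x, y] ++ q) := by simpa using hw
  refine this.not_of_replace h.mEquiv_swap (by simp [h.ne]) ?_
  simp [wordHammingDist_cons, wordHammingDist_nil, h.ne, h.ne.symm]

theorem wordHammingDist_flip (x : Fin 3) (hx : x ≠ 1) (q : List (Fin 3)) :
    wordHammingDist ([1, x] ++ q ++ [x, 1]) ([x, 1] ++ q ++ [1, x]) = 4 := by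
  rw [wordHammingDist_append (by simp), wordHammingDist_append (by simp), wordHammingDist_self]
  simp [wordHammingDist_cons, wordHammingDist_nil, hx, hx.symm]

theorem not_flip (h : OuterPair x y) {p q r : List (Fin 3)} (hq : y ∉ q)
    (hw : Sparse (p ++ ([1, x] ++ q ++ [x, 1]) ++ r)) : False :=
  hw.not_of_replace (h.mEquiv_flip hq) (by simp [h.left.symm])
    (wordHammingDist_flip x h.left q).le

theorem not_flip' (h : OuterPair x y) {p q r : List (Fin 3)} (hq : y ∉ q)
    (hw : Sparse (p ++ ([x, 1] ++ q ++ [1, x]) ++ r)) : False :=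
  hw.not_of_replace (h.mEquiv_flip hq).symm (by simp [h.left])
    (by rw [wordHammingDist_comm, wordHammingDist_flip x h.left q])

/-- The moves `mEquiv_zigzag_left` and `mEquiv_zigzag_right` lower p + s while staying in a sparse
class; outer gaps of length 0 are excluded by adjacency. -/
theorem zigzag_gaps (h : OuterPair x y) {a b : List (Fin 3)} {p q r s : ℕ}
    (hw : Sparse (a ++ zigzag x y p q r s ++ b)) : p = 1 ∧ s = 1 := by
  induction hn : p + s using Nat.strong_induction_on generalizing a b p q r s with
  | _ n ih =>
    subst hn
    have hp : p ≠ 0 := by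
      rintro rfl
      exact not_adjacent h (p := a) (by simpa [zigzag] using hw)
    have hs : s ≠ 0 := by
      rintro rfl
      exact not_adjacent h.symm
        (p := a ++ x :: (List.replicate p 1 ++ y :: (List.replicate q 1 ++
          x :: List.replicate r 1))) (q := b) (by simpa [zigzag] using hw)
    have h1 : 2 ≤ s → p - 1 = 1 ∧ s - 2 = 1 := by
      intro h2
      obtain ⟨p, rfl⟩ := Nat.exists_eq_add_of_le' (Nat.pos_of_ne_zero hp)
      obtain ⟨s, rfl⟩ := Nat.exists_eq_add_of_le' h2
      have := hw.replace (h.mEquiv_zigzag_left p q r s)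
      rw [List.append_assoc, List.append_assoc, ← List.append_assoc a] at this
      simpa using ih (p + s) (by omega) this rfl
    have h2 : 2 ≤ p → p - 2 = 1 ∧ s - 1 = 1 := by
      intro h2
      obtain ⟨p, rfl⟩ := Nat.exists_eq_add_of_le' h2
      obtain ⟨s, rfl⟩ := Nat.exists_eq_add_of_le' (Nat.pos_of_ne_zero hs)
      have := hw.replace (h.mEquiv_zigzag_right p q r s)
      rw [← List.singleton_append, ← List.append_assoc a] at this
      simpa using ih (p + s) (by omega) this rfl
    -- By induction, 2 ≤ s gives (p, s) = (2, 3) and 2 ≤ p gives (3, 2); each case triggers the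
    -- other, so neither occurs.
    omega

/-- If r ≥ 2, the letter b in front allows the shift, which produces a zigzag with first gap 2,
against `zigzag_gaps`. -/
theorem zigzag_left (h : OuterPair x y) {a b : List (Fin 3)} {p q r s : ℕ}
    (hw : Sparse (a ++ [1] ++ zigzag x y p q r s ++ b)) : r + s = 2 := by
  obtain ⟨rfl, rfl⟩ := hw.zigzag_gaps h
  have hr : r ≠ 0 := by
    rintro rfl
    exact not_adjacent h (p := a ++ 1 :: x :: 1 :: y :: List.replicate q 1) (q := 1 :: x :: b)
      (by simpa [zigzag] using hw)
  by_contra hc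
  obtain ⟨r, rfl⟩ := Nat.exists_eq_add_of_le' (show 2 ≤ r by omega)
  have h1 : Sparse (a ++ (1 :: zigzag x y 1 q (r + 2) (0 + 1)) ++ b) := by simpa using hw
  have h2 := h1.replace (h.mEquiv_zigzag_shift 1 q r 0)
  rw [List.append_assoc, List.append_assoc, ← List.append_assoc a] at h2
  have := h2.zigzag_gaps h
  omega

theorem zigzag_right (h : OuterPair x y) {a b : List (Fin 3)} {p q r s : ℕ}
    (hw : Sparse (a ++ zigzag x y p q r s ++ ([1] ++ b))) : p + q = 2 := by
  obtain ⟨rfl, rfl⟩ := hw.zigzag_gaps h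
  have hq : q ≠ 0 := by
    rintro rfl
    exact not_adjacent h.symm (p := a ++ [x, 1])
      (q := List.replicate r 1 ++ y :: 1 :: x :: 1 :: b) (by simpa [zigzag] using hw)
  by_contra hc
  obtain ⟨q, rfl⟩ := Nat.exists_eq_add_of_le' (show 2 ≤ q by omega)
  have h1 : Sparse (a ++ (zigzag x y (0 + 1) (q + 2) r 1 ++ [1]) ++ b) := by simpa using hw
  have h2 := h1.replace (h.mEquiv_zigzag_shift 0 q r 1).symm
  rw [← List.singleton_append, ← List.append_assoc a] at h2
  have := h2.zigzag_gaps h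
  omega

end Sparse

/-! ### Sparse words have rigid heights -/

section heights

variable {x : Fin 3}

theorem mem_heights_append {u v : List (Fin 3)} {i : ℕ} : i ∈ heights x (u ++ v) ↔
    i ∈ heights x u ∨ ∃ k ∈ heights x v, k + u.count 1 = i := by
  simp [heights_append]

theorem mem_heights_split (hx : x ≠ 1) (u v : List (Fin 3)) :
    u.count 1 ∈ heights x (u ++ x :: v) := by
  simp [heights_append, heights_self_cons hx]

theorem exists_mem_heights (hx : x ≠ 1) {w : List (Fin 3)} (h : x ∈ w) : ∃ i, i ∈ heights x w := by
  refine List.exists_mem_of_length_pos ?_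
  rw [length_heights hx]
  exact List.count_pos_iff.2 h

theorem zero_mem_heights (hx : x ≠ 1) {w : List (Fin 3)} (h : x ∈ w) (h1 : w.count 1 = 0) :
    0 ∈ heights x w := by
  obtain ⟨i, hi⟩ := exists_mem_heights hx h
  have := le_of_mem_heights hi
  rwa [show i = 0 by omega] at hi

theorem exists_split_first_append (hx : x ≠ 1) {u v : List (Fin 3)} {i : ℕ}
    (h : i ∈ heights x (u ++ v)) (hi : u.count 1 < i) : ∃ q r, v = q ++ x :: r ∧
      u.count 1 + q.count 1 = i ∧ i - u.count 1 ∉ heights x q := by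
  rcases mem_heights_append.1 h with h | ⟨k, hk, rfl⟩
  · have := le_of_mem_heights h
    omega
  · obtain ⟨q, r, rfl, h1, h2⟩ := exists_split_first hx hk
    exact ⟨q, r, rfl, by omega, by simpa using h2⟩

theorem count_one_append_cons (hx : x ≠ 1) (u v : List (Fin 3)) :
    (u ++ x :: v).count 1 = u.count 1 + v.count 1 := by
  simp [hx]

theorem OuterPair.count_one_eq_length {y : Fin 3} (h : OuterPair x y) {p : List (Fin 3)}
    (hx : x ∉ p) (hy : y ∉ p) : p.count 1 = p.length := by
  conv_lhs => rw [h.eq_replicate_one hx hy]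
  simp

theorem two_le_count_heights (hx : x ≠ 1) {u v : List (Fin 3)} (h : 0 ∈ heights x v) :
    2 ≤ (heights x (u ++ x :: v)).count (u.count 1) := by
  rw [heights_append, heights_self_cons hx, List.map_cons, List.count_append, List.count_cons]
  have : 0 < ((heights x v).map (· + u.count 1)).count (u.count 1) :=
    List.count_pos_iff.2 (List.mem_map.2 ⟨0, h, by simp⟩)
  simp
  omega

theorem exists_last_split {y : Fin 3} {w : List (Fin 3)} (h : y ∈ w) :
    ∃ p q, w = p ++ y :: q ∧ y ∉ q := by
  obtain ⟨a, b, hab, ha⟩ := List.eq_append_cons_of_mem (List.mem_reverse.2 h)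
  refine ⟨b.reverse, a.reverse, ?_, by simpa using ha⟩
  rw [← List.reverse_reverse w, hab]
  simp

theorem exists_last_one {w : List (Fin 3)} (h : 0 < w.count 1) :
    ∃ p q, w = p ++ 1 :: q ∧ 1 ∉ q :=
  exists_last_split (List.count_pos_iff.1 h)

end heights

theorem cons_append_comm {x : Fin 3} {p : List (Fin 3)} (h : p = List.replicate p.length x)
    (v : List (Fin 3)) : x :: (p ++ v) = p ++ x :: v := by
  rw [h, ← List.cons_append, ← List.replicate_succ, List.replicate_succ']
  simp

namespace Sparse

variable {x y : Fin 3} {w : List (Fin 3)}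

theorem disjoint_heights (h : OuterPair x y) (hw : Sparse w) {i : ℕ} (hi : i ∈ heights x w) :
    i ∉ heights y w := by
  intro hy
  obtain ⟨p, r, rfl, rfl, hp⟩ := exists_split_first h.left hi
  rcases mem_heights_append.1 hy with hy | ⟨k, hk, hk'⟩
  · obtain ⟨p, q, rfl, h1, h2⟩ := exists_split_last h.right hy
    have hq1 : q.count 1 = 0 := by
      rw [count_one_append_cons h.right] at h1
      omega
    have hq := h.symm.symm.eq_replicate (p := q) (List.count_eq_zero.1 hq1) fun hq =>
      h2 (zero_mem_heights h.right hq hq1)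
    refine not_adjacent h.symm (p := p) (q := q ++ r) ?_
    rw [cons_append_comm hq]
    simpa using hw
  · obtain rfl : k = 0 := by omega
    rw [heights_cons_of_ne h.left h.ne] at hk
    obtain ⟨q, r, rfl, h1, h2⟩ := exists_split_first h.right hk
    have hq := h.eq_replicate (p := q) (List.count_eq_zero.1 h1) fun hq =>
      h2 (zero_mem_heights h.right hq h1)
    refine not_adjacent h (p := p ++ q) (q := r) ?_
    rw [List.append_assoc, ← cons_append_comm hq]
    exact hw

/-- Between each x and the nearest b outside only x's can occur, by disjointness of heights. Sliding
x next to these b's exposes a forbidden flip. -/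
theorem not_outward (h : OuterPair x y) {p q r : List (Fin 3)}
    (hw : Sparse (p ++ x :: (q ++ x :: r))) (hq : y ∉ q) (hp : 0 < p.count 1)
    (hr : 0 < r.count 1) : False := by
  obtain ⟨p, p', rfl, hp'⟩ := exists_last_one hp
  obtain ⟨r', r, rfl, hr'⟩ := List.eq_append_cons_of_mem (List.count_pos_iff.1 hr)
  have hyp : y ∉ p' := by
    intro hy
    have h0 := zero_mem_heights h.right hy (List.count_eq_zero.2 hp')
    refine hw.disjoint_heights h (mem_heights_split h.left _ _) ?_
    refine mem_heights_append.2 (Or.inl (mem_heights_append.2 (Or.inr ⟨1, ?_, ?_⟩)))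
    · simpa [heights_one_cons] using h0
    · simp [List.count_eq_zero.2 hp']
      omega
  have hyr : y ∉ r' := by
    intro hy
    have h0 := zero_mem_heights h.right hy (List.count_eq_zero.2 hr')
    have e : p ++ 1 :: p' ++ x :: (q ++ x :: (r' ++ 1 :: r)) =
      (p ++ 1 :: p' ++ x :: q) ++ x :: (r' ++ 1 :: r) := by simp
    rw [e] at hw
    refine hw.disjoint_heights h (mem_heights_split h.left _ _) ?_
    refine mem_heights_append.2 (Or.inr ⟨0, ?_, by simp⟩)
    rw [heights_cons_of_ne h.left h.ne]
    exact mem_heights_append.2 (Or.inl h0)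
  have e1 := h.eq_replicate hp' hyp
  have e2 := h.eq_replicate hr' hyr
  refine not_flip h (p := p) (q := p' ++ q ++ r') (r := r) (by simp [hyp, hq, hyr]) ?_
  have e3 := cons_append_comm e1
  have e4 := cons_append_comm e2
  simpa [e3, e4] using hw

theorem not_inward (h : OuterPair x y) {p q r : List (Fin 3)}
    (hw : Sparse (p ++ x :: (q ++ x :: r))) (hq : y ∉ q) (h2 : 2 ≤ q.count 1) : False := by
  obtain ⟨a, q, rfl, ha⟩ := List.eq_append_cons_of_mem
    (List.count_pos_iff.1 (show 0 < q.count 1 by omega))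
  have h3 : 0 < q.count 1 := by
    have h4 := List.count_eq_zero.2 ha
    rw [List.count_append, List.count_cons_self] at h2
    omega
  obtain ⟨q, c, rfl, hc⟩ := exists_last_one h3
  simp only [List.mem_append, List.mem_cons, not_or] at hq
  have e1 := h.eq_replicate ha hq.1
  have e2 := h.eq_replicate hc hq.2.2.2.2
  refine not_flip' h (p := p ++ a) (q := q) (r := c ++ r) hq.2.2.1 ?_
  have e3 := cons_append_comm e1
  have e4 := cons_append_comm e2
  simpa [e3, e4] using hw

theorem heights_two (h : OuterPair x y) (hw : Sparse w) {i : ℕ}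
    (hi : 2 ≤ (heights x w).count i) : i = 0 ∨ i = w.count 1 := by
  obtain ⟨p, r, rfl, rfl, hp⟩ := exists_split_first h.left
    (List.count_pos_iff.1 (show 0 < (heights x w).count i by omega))
  have h0 : 0 ∈ heights x r := by
    rw [heights_append, List.count_append, List.count_eq_zero.2 hp, heights_self_cons h.left,
      List.map_cons, List.count_cons] at hi
    simp only [Nat.zero_add, beq_self_eq_true, if_true] at hi
    obtain ⟨k, hk, hk'⟩ := List.mem_map.1 (List.count_pos_iff.1
      (show 0 < ((heights x r).map (· + p.count 1)).count (p.count 1) by omega))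
    rwa [show k = 0 by simpa using hk'] at hk
  obtain ⟨q, r, rfl, h1, -⟩ := exists_split_first h.left h0
  have hq : y ∉ q := by
    intro hy
    refine hw.disjoint_heights h (mem_heights_split h.left _ _) ?_
    refine mem_heights_append.2 (Or.inr ⟨0, ?_, by simp⟩)
    rw [heights_cons_of_ne h.left h.ne]
    exact mem_heights_append.2 (Or.inl (zero_mem_heights h.right hy h1))
  by_contra! hc
  refine not_outward h hw hq (Nat.pos_of_ne_zero hc.1) (Nat.pos_of_ne_zero fun h4 => hc.2 ?_)
  simp [h4, h1, h.left]

theorem heights_adj (h : OuterPair x y) (hw : Sparse w) {i j : ℕ} (hi : i ∈ heights x w)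
    (hj : j ∈ heights x w) (hij : i < j) (hk : ∀ k ∈ heights y w, i < k → j ≤ k) :
    (i = 0 ∨ j = w.count 1) ∧ j ≤ i + 1 := by
  obtain ⟨p, r, rfl, rfl, hp⟩ := exists_split_first h.left hi
  have hj' := hj
  rw [← List.singleton_append, ← List.append_assoc] at hj'
  obtain ⟨q, r, rfl, h1, -⟩ := exists_split_first_append h.left hj' (by simpa [h.left] using hij)
  rw [List.count_append, List.count_singleton] at h1
  simp only [beq_iff_eq, h.left, if_false, Nat.add_zero] at h1
  have hq : y ∉ q := by
    intro hy
    obtain ⟨k, hk1⟩ := exists_mem_heights h.right hy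
    have hk2 := le_of_mem_heights hk1
    have hk3 : k + p.count 1 ∈ heights y (p ++ x :: (q ++ x :: r)) := by
      refine mem_heights_append.2 (Or.inr ⟨k, ?_, rfl⟩)
      rw [heights_cons_of_ne h.left h.ne]
      exact mem_heights_append.2 (Or.inl hk1)
    have h4 : k ≠ 0 := by
      rintro rfl
      rw [Nat.zero_add] at hk3
      exact hw.disjoint_heights h hi hk3
    have h5 : k + p.count 1 ≠ j := by
      rintro h5
      rw [h5] at hk3
      exact hw.disjoint_heights h hj hk3
    have := hk _ hk3 (by omega)
    omega
  constructor
  · by_contra! hc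
    refine not_outward h hw hq (Nat.pos_of_ne_zero hc.1) (Nat.pos_of_ne_zero fun h4 => hc.2 ?_)
    simp [h4, h1, h.left]
  · by_contra! hc
    exact not_inward h hw hq (by omega)

/-- Cut at the last x of height x₁ and then at successive first occurrences. Consecutiveness keeps
further x's out of the pieces; a second y within a gap would allow an outward move. -/
theorem exists_zigzag (h : OuterPair x y) (hw : Sparse w) {x₁ x₂ x₃ : ℕ}
    (h₁ : x₁ ∈ heights x w) (h₂ : x₂ ∈ heights x w) (h₃ : x₃ ∈ heights x w)
    (c₁ : ∀ k ∈ heights x w, x₁ < k → x₂ ≤ k) (c₂ : ∀ k ∈ heights x w, x₂ < k → x₃ ≤ k)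
    (hy₁ : ∃ z ∈ heights y w, x₁ < z ∧ z < x₂) (hy₂ : ∃ z ∈ heights y w, x₂ < z ∧ z < x₃) :
    ∃ a b p q r s, w = a ++ zigzag x y p q r s ++ b ∧ a.count 1 = x₁ ∧ x₁ + (p + q) = x₂ ∧
      x₂ + (r + s) = x₃ := by
  obtain ⟨y₁, hy₁, l₁, l₂⟩ := hy₁
  obtain ⟨y₂, hy₂, l₃, l₄⟩ := hy₂
  have hx1 := h.left
  have hy1 := h.right
  have d₁ := hw.disjoint_heights h h₁
  have d₂ := hw.disjoint_heights h h₂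
  have d₃ := hw.disjoint_heights h h₃
  have t₂ := hw.heights_two h (i := x₂)
  have b₃ := le_of_mem_heights h₃
  obtain ⟨a, v, hv, e₀, f₁⟩ := exists_split_last h.left h₁
  have hv' : w = (a ++ [x]) ++ v := by simp [hv]
  obtain ⟨q₁, v₁, rfl, e₁, -⟩ := exists_split_first_append h.right (hv' ▸ hy₁)
    (by simpa [hx1, e₀] using l₁)
  have hv₁ : w = (a ++ [x] ++ q₁ ++ [y]) ++ v₁ := by simp [hv]
  obtain ⟨q₂, v₂, rfl, e₂, f₂⟩ := exists_split_first_append h.left (hv₁ ▸ h₂)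
    (by simp [hx1, hy1] at e₁ ⊢; omega)
  have hv₂ : w = (a ++ [x] ++ q₁ ++ [y] ++ q₂ ++ [x]) ++ v₂ := by simp [hv]
  obtain ⟨q₃, v₃, rfl, e₃, -⟩ := exists_split_first_append h.right (hv₂ ▸ hy₂)
    (by simp [hx1, hy1] at e₁ e₂ ⊢; omega)
  have hv₃ : w = (a ++ [x] ++ q₁ ++ [y] ++ q₂ ++ [x] ++ q₃ ++ [y]) ++ v₃ := by simp [hv]
  obtain ⟨q₄, b, rfl, e₄, f₄⟩ := exists_split_first_append h.left (hv₃ ▸ h₃)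
    (by simp [hx1, hy1] at e₁ e₂ e₃ ⊢; omega)
  simp [hx1, hy1] at e₁ e₂ e₃ e₄ f₂ f₄
  have mem : ∀ (z : Fin 3) (u q v : List (Fin 3)) (k : ℕ), w = u ++ q ++ v → k ∈ heights z q →
      k + u.count 1 ∈ heights z w ∧ k ≤ q.count 1 := by
    rintro z u q v k rfl hk
    refine ⟨?_, le_of_mem_heights hk⟩
    rw [List.append_assoc]
    exact mem_heights_append.2 (Or.inr ⟨k, mem_heights_append.2 (Or.inl hk), rfl⟩)
  have m₁ := fun z k => mem z (a ++ [x]) q₁ (y :: (q₂ ++ x :: (q₃ ++ y :: (q₄ ++ x :: b)))) k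
    (by simp [hv])
  have m₂ := fun z k => mem z (a ++ [x] ++ q₁ ++ [y]) q₂ (x :: (q₃ ++ y :: (q₄ ++ x :: b))) k
    (by simp [hv])
  have m₃ := fun z k => mem z (a ++ [x] ++ q₁ ++ [y] ++ q₂ ++ [x]) q₃ (y :: (q₄ ++ x :: b)) k
    (by simp [hv])
  have m₄ := fun z k => mem z (a ++ [x] ++ q₁ ++ [y] ++ q₂ ++ [x] ++ q₃ ++ [y]) q₄ (x :: b) k
    (by simp [hv])
  simp [hx1, hy1] at m₁ m₂ m₃ m₄
  have n₁ : x ∉ q₁ := by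
    intro hx
    obtain ⟨k, hk⟩ := exists_mem_heights h.left hx
    obtain ⟨g₁, g₂⟩ := m₁ x k hk
    have := c₁ _ g₁
    obtain rfl : k = 0 := by omega
    exact f₁ (mem_heights_append.2 (Or.inl hk))
  have n₂ : x ∉ q₂ := by
    intro hx
    obtain ⟨k, hk⟩ := exists_mem_heights h.left hx
    obtain ⟨g₁, g₂⟩ := m₂ x k hk
    have := c₁ _ g₁
    refine f₂ ?_
    rwa [show x₂ - (a.count 1 + q₁.count 1) = k by omega]
  have n₃ : x ∉ q₃ := by
    intro hx
    obtain ⟨k, hk⟩ := exists_mem_heights h.left hx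
    obtain ⟨g₁, g₂⟩ := m₃ x k hk
    have := c₂ _ g₁
    obtain rfl : k = 0 := by omega
    have h5 := two_le_count_heights h.left (u := a ++ [x] ++ q₁ ++ [y] ++ q₂)
      (v := q₃ ++ y :: (q₄ ++ x :: b)) (mem_heights_append.2 (Or.inl hk))
    have h6 : a ++ [x] ++ q₁ ++ [y] ++ q₂ ++ x :: (q₃ ++ y :: (q₄ ++ x :: b)) = w := by simp [hv]
    rw [h6] at h5
    simp [hx1, hy1] at h5
    rw [← e₂] at t₂
    have := t₂ (by simpa [Nat.add_assoc] using h5)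
    omega
  have n₄ : x ∉ q₄ := by
    intro hx
    obtain ⟨k, hk⟩ := exists_mem_heights h.left hx
    obtain ⟨g₁, g₂⟩ := m₄ x k hk
    have := c₂ _ g₁
    refine f₄ ?_
    rwa [show x₃ - (a.count 1 + (q₁.count 1 + (q₂.count 1 + q₃.count 1))) = k by omega]
  have hB : w.count 1 = a.count 1 + q₁.count 1 + q₂.count 1 + q₃.count 1 + q₄.count 1 +
      b.count 1 := by
    simp [hv, hx1, hy1, Nat.add_assoc]
  have s₁ : y ∉ q₁ := by
    intro hy
    obtain ⟨i, hi⟩ := exists_mem_heights h.right hy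
    obtain ⟨c, d, rfl, hd⟩ := exists_last_split hy
    have hcd := count_one_append_cons h.right c d
    simp only [List.mem_append, List.mem_cons, not_or] at n₁
    refine not_outward h.symm (p := a ++ [x] ++ c) (q := d)
      (r := q₂ ++ x :: (q₃ ++ y :: (q₄ ++ x :: b))) (by simpa [hv] using hw) n₁.2.2 ?_ ?_
    · obtain ⟨g₁, g₂⟩ := m₁ y (c.count 1) (mem_heights_split h.right _ _)
      by_contra hc
      simp only [List.count_append, List.count_cons, List.count_nil, beq_iff_eq, hx1, if_false] at hc
      refine d₁ ?_
      convert g₁ using 1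
      omega
    · simp only [List.count_append, List.count_cons, beq_iff_eq, hx1, hy1, if_false]
      omega
  have s₂ : y ∉ q₂ := by
    intro hy
    obtain ⟨c, d, rfl, hc⟩ := List.eq_append_cons_of_mem hy
    have hcd := count_one_append_cons h.right c d
    simp only [List.mem_append, List.mem_cons, not_or] at n₂
    refine not_outward h.symm (p := a ++ [x] ++ q₁) (q := c)
      (r := d ++ x :: (q₃ ++ y :: (q₄ ++ x :: b))) (by simpa [hv] using hw) n₂.1 ?_ ?_
    · simp only [List.count_append, List.count_cons, List.count_nil, beq_iff_eq, hx1, if_false]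
      omega
    · simp only [List.count_append, List.count_cons, beq_iff_eq, hx1, hy1, if_false]
      omega
  have s₃ : y ∉ q₃ := by
    intro hy
    obtain ⟨c, d, rfl, hd⟩ := exists_last_split hy
    have hcd := count_one_append_cons h.right c d
    simp only [List.mem_append, List.mem_cons, not_or] at n₃
    refine not_outward h.symm (p := a ++ [x] ++ q₁ ++ [y] ++ q₂ ++ [x] ++ c) (q := d)
      (r := q₄ ++ x :: b) (by simpa [hv] using hw) n₃.2.2 ?_ ?_
    · simp only [List.count_append, List.count_cons, List.count_nil, beq_iff_eq, hx1, hy1, if_false]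
      omega
    · simp only [List.count_append, List.count_cons, beq_iff_eq, hx1, if_false]
      omega
  have s₄ : y ∉ q₄ := by
    intro hy
    obtain ⟨c, d, rfl, hc⟩ := List.eq_append_cons_of_mem hy
    have hcd := count_one_append_cons h.right c d
    simp only [List.mem_append, List.mem_cons, not_or] at n₄
    refine not_outward h.symm (p := a ++ [x] ++ q₁ ++ [y] ++ q₂ ++ [x] ++ q₃) (q := c)
      (r := d ++ x :: b) (by simpa [hv] using hw) n₄.1 ?_ ?_
    · simp only [List.count_append, List.count_cons, List.count_nil, beq_iff_eq, hx1, hy1, if_false]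
      omega
    · obtain ⟨g₁, g₂⟩ := m₄ y (c.count 1) (mem_heights_split h.right _ _)
      by_contra hc
      simp only [List.count_append, List.count_cons, beq_iff_eq, hx1, if_false] at hc
      refine d₃ ?_
      convert g₁ using 1
      omega
  refine ⟨a, b, q₁.length, q₂.length, q₃.length, q₄.length, ?_, e₀, ?_, ?_⟩
  · rw [zigzag, ← h.eq_replicate_one n₁ s₁, ← h.eq_replicate_one n₂ s₂,
      ← h.eq_replicate_one n₃ s₃, ← h.eq_replicate_one n₄ s₄, hv]
    simp
  all_goals
    have r₁ := h.count_one_eq_length n₁ s₁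
    have r₂ := h.count_one_eq_length n₂ s₂
    have r₃ := h.count_one_eq_length n₃ s₃
    have r₄ := h.count_one_eq_length n₄ s₄
    omega

theorem rigid_heights (h : OuterPair x y) (hw : Sparse w) :
    Rigid (w.count 1) (heights x w) (heights y w) where
  le _ := le_of_mem_heights
  disj _ := hw.disjoint_heights h
  two _ := hw.heights_two h
  adj _ hi _ hj := hw.heights_adj h hi hj
  left x₁ h₁ x₂ h₂ x₃ h₃ l₁ l₂ c₁ c₂ hy₁ hy₂ h1 := by
    obtain ⟨a, b, p, q, r, s, rfl, e₀, e₁, e₂⟩ := hw.exists_zigzag h h₁ h₂ h₃ c₁ c₂ hy₁ hy₂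
    obtain ⟨a, a', rfl, ha'⟩ := exists_last_one (w := a) (by omega)
    have hB := le_of_mem_heights h₂
    -- Letters between the last b and the zigzag have height x₁: a y contradicts disjointness, an x
    -- makes x₁ a double interior height. So that b is adjacent to the zigzag.
    have ha : a' = [] := by
      have h2 : y ∉ a' := by
        intro hy
        have h0 := zero_mem_heights h.right hy (List.count_eq_zero.2 ha')
        refine hw.disjoint_heights h h₁ ?_
        rw [List.append_assoc]
        refine mem_heights_append.2 (Or.inl (mem_heights_append.2 (Or.inr ⟨1, ?_, ?_⟩)))
        · simpa [heights_one_cons] using h0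
        · simp [List.count_eq_zero.2 ha'] at e₀
          omega
      have h3 := h.eq_replicate ha' h2
      cases hn : a'.length with
      | zero => exact List.length_eq_zero_iff.1 hn
      | succ n =>
        rw [hn, List.replicate_succ'] at h3
        have h4 := two_le_count_heights h.left (u := a ++ 1 :: List.replicate n x)
          (v := zigzag x y p q r s ++ b) (by simp [zigzag, heights_self_cons h.left])
        have h5 : (a ++ 1 :: List.replicate n x).count 1 = x₁ := by
          rw [← e₀, h3]
          simp [h.left]
        rw [h5] at h4
        have h6 := hw.heights_two h (i := x₁) (by simpa [h3] using h4)
        omega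
    subst ha
    have := zigzag_left h hw
    omega
  right x₁ h₁ x₂ h₂ x₃ h₃ l₁ l₂ c₁ c₂ hy₁ hy₂ h1 := by
    obtain ⟨a, b, p, q, r, s, rfl, e₀, e₁, e₂⟩ := hw.exists_zigzag h h₁ h₂ h₃ c₁ c₂ hy₁ hy₂
    have hz : (zigzag x y p q r s).count 1 = p + q + r + s := by
      simp [zigzag, h.left, h.right]
      omega
    have hb : 0 < b.count 1 := by
      simp only [List.count_append, hz] at h1
      omega
    obtain ⟨b', b, rfl, hb'⟩ := List.eq_append_cons_of_mem (List.count_pos_iff.1 hb)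
    have e : a ++ zigzag x y p q r s ++ (b' ++ 1 :: b) = (a ++ x :: (List.replicate p 1 ++
        y :: (List.replicate q 1 ++ x :: (List.replicate r 1 ++ y :: List.replicate s 1)))) ++
        x :: (b' ++ 1 :: b) := by simp [zigzag]
    have e' : (a ++ x :: (List.replicate p 1 ++ y :: (List.replicate q 1 ++
        x :: (List.replicate r 1 ++ y :: List.replicate s 1)))).count 1 = x₃ := by
      simp [h.left, h.right]
      omega
    have hb : b' = [] := by
      have h2 : y ∉ b' := by
        intro hy
        have h0 := zero_mem_heights h.right hy (List.count_eq_zero.2 hb')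
        refine hw.disjoint_heights h h₃ ?_
        rw [e, ← e']
        refine mem_heights_append.2 (Or.inr ⟨0, ?_, by simp⟩)
        rw [heights_cons_of_ne h.left h.ne]
        exact mem_heights_append.2 (Or.inl h0)
      have h3 : x ∉ b' := by
        intro hx
        have h0 := zero_mem_heights h.left hx (List.count_eq_zero.2 hb')
        have h4 := two_le_count_heights h.left (u := a ++ x :: (List.replicate p 1 ++
          y :: (List.replicate q 1 ++ x :: (List.replicate r 1 ++ y :: List.replicate s 1))))
          (v := b' ++ 1 :: b) (mem_heights_append.2 (Or.inl h0))
        rw [← e, e'] at h4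
        have := hw.heights_two h h4
        omega
      have h4 := h.count_one_eq_length h3 h2
      rw [List.count_eq_zero.2 hb'] at h4
      exact List.length_eq_zero_iff.1 h4.symm
    subst hb
    have := zigzag_right h hw
    omega

end Sparse

/-! ### Alternating words with two letters of each outer kind -/

/-- The word in which the letters `x`, `y`, `x`, `y` are separated by powers of `b`. -/
def alternating (x y : Fin 3) (a b c d e : ℕ) : List (Fin 3) :=
  List.replicate a 1 ++ x :: (List.replicate b 1 ++ y :: (List.replicate c 1 ++
    x :: (List.replicate d 1 ++ y :: List.replicate e 1)))

section alternating

variable {x y : Fin 3}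

theorem OuterPair.exists_eq_alternating (h : OuterPair x y) {w : List (Fin 3)}
    (hx : w.count x = 2) (hy : w.count y = 2) {i₁ i₂ i₃ i₄ : ℕ} (h₁ : i₁ ∈ heights x w)
    (h₂ : i₂ ∈ heights y w) (h₃ : i₃ ∈ heights x w) (h₄ : i₄ ∈ heights y w) (l₁ : i₁ < i₂)
    (l₂ : i₂ < i₃) (l₃ : i₃ < i₄) : ∃ a b c d e, w = alternating x y a b c d e := by
  have hx1 := h.left
  have hy1 := h.right
  obtain ⟨a, v, hv, e₀, -⟩ := exists_split_first h.left h₁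
  have hv' : w = (a ++ [x]) ++ v := by simp [hv]
  obtain ⟨q₁, v₁, rfl, e₁, -⟩ := exists_split_first_append h.right (hv' ▸ h₂)
    (by simpa [hx1, e₀] using l₁)
  have hv₁ : w = (a ++ [x] ++ q₁ ++ [y]) ++ v₁ := by simp [hv]
  obtain ⟨q₂, v₂, rfl, e₂, -⟩ := exists_split_first_append h.left (hv₁ ▸ h₃)
    (by simp [hx1, hy1] at e₁ ⊢; omega)
  have hv₂ : w = (a ++ [x] ++ q₁ ++ [y] ++ q₂ ++ [x]) ++ v₂ := by simp [hv]
  obtain ⟨q₃, v₃, rfl, e₃, -⟩ := exists_split_first_append h.right (hv₂ ▸ h₄)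
    (by simp [hx1, hy1] at e₁ e₂ ⊢; omega)
  rw [hv] at hx hy
  simp only [List.count_append, List.count_cons, beq_self_eq_true, beq_iff_eq, h.ne, h.ne.symm,
    if_true, if_false] at hx hy
  have key : ∀ p : List (Fin 3), p.count x = 0 → p.count y = 0 → List.replicate p.length 1 = p :=
    fun p h1 h2 => (h.eq_replicate_one (List.count_eq_zero.1 h1) (List.count_eq_zero.1 h2)).symm
  refine ⟨a.length, q₁.length, q₂.length, q₃.length, v₃.length, ?_⟩
  rw [alternating, key a, key q₁, key q₂, key q₃, key v₃, hv] <;> omega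

theorem wordHammingDist_move {l : Fin 3} (hl : l ≠ 1) (t : ℕ) :
    wordHammingDist (List.replicate (t + 1) 1 ++ [l]) (l :: List.replicate (t + 1) 1) = 2 := by
  have e1 : List.replicate (t + 1) 1 ++ [l] = 1 :: (List.replicate t 1 ++ [l]) := rfl
  rw [e1, List.replicate_succ', wordHammingDist_cons, wordHammingDist_append rfl,
    wordHammingDist_self]
  simp [wordHammingDist_cons, wordHammingDist_nil, hl, hl.symm]

/-- Four positions carry an outer letter in one of the two words; two of them coincide exactly when
t = c, where x meets y. -/
theorem OuterPair.wordHammingDist_middle (h : OuterPair x y) (c t : ℕ) :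
    wordHammingDist (y :: (List.replicate c 1 ++ x :: List.replicate (t + 1) 1))
      (List.replicate (t + 1) 1 ++ y :: (List.replicate c 1 ++ [x])) ∈ ({3, 4} : Set ℕ) := by
  have hx := h.left
  have hy := h.right
  have hne := h.ne
  rcases Nat.lt_trichotomy t c with hlt | rfl | hlt
  · obtain ⟨k, rfl⟩ := Nat.exists_eq_add_of_lt hlt
    have e1 : y :: (List.replicate (t + k + 1) 1 ++ x :: List.replicate (t + 1) 1) =
        [y] ++ (List.replicate t 1 ++ ([1] ++ (List.replicate k 1 ++ ([x] ++
          (List.replicate t 1 ++ [1]))))) := by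
      have : t + k + 1 = t + (1 + k) := by omega
      rw [this]
      simp only [List.replicate_add, List.replicate_one, List.append_assoc, List.cons_append, List.nil_append]
    have e2 : List.replicate (t + 1) 1 ++ y :: (List.replicate (t + k + 1) 1 ++ [x]) =
        [1] ++ (List.replicate t 1 ++ ([y] ++ (List.replicate k 1 ++ ([1] ++
          (List.replicate t 1 ++ [x]))))) := by
      have : t + k + 1 = k + (1 + t) := by omega
      rw [this, Nat.add_comm t 1]
      simp only [List.replicate_add, List.replicate_one, List.append_assoc, List.cons_append, List.nil_append]
    rw [e1, e2]
    iterate 6 rw [wordHammingDist_append (by simp)]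
    simp [wordHammingDist_self, wordHammingDist_cons, hx, hy, hx.symm, hy.symm]
  · have e1 : y :: (List.replicate t 1 ++ x :: List.replicate (t + 1) 1) =
        [y] ++ (List.replicate t 1 ++ ([x] ++ (List.replicate t 1 ++ [1]))) := by
      simp [List.replicate_succ']
    have e2 : List.replicate (t + 1) 1 ++ y :: (List.replicate t 1 ++ [x]) =
        [1] ++ (List.replicate t 1 ++ ([y] ++ (List.replicate t 1 ++ [x]))) := by
      simp [List.replicate_succ]
    rw [e1, e2]
    iterate 4 rw [wordHammingDist_append (by simp)]
    simp [wordHammingDist_self, wordHammingDist_cons, hx.symm, hy, hne]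
  · obtain ⟨k, rfl⟩ := Nat.exists_eq_add_of_lt hlt
    have e1 : y :: (List.replicate c 1 ++ x :: List.replicate (c + k + 1 + 1) 1) =
        [y] ++ (List.replicate c 1 ++ ([x] ++ (List.replicate k 1 ++ ([1] ++
          (List.replicate c 1 ++ [1]))))) := by
      have : c + k + 1 + 1 = k + (1 + (c + 1)) := by omega
      rw [this]
      simp only [List.replicate_add, List.replicate_one, List.cons_append, List.nil_append]
    have e2 : List.replicate (c + k + 1 + 1) 1 ++ y :: (List.replicate c 1 ++ [x]) =
        [1] ++ (List.replicate c 1 ++ ([1] ++ (List.replicate k 1 ++ ([y] ++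
          (List.replicate c 1 ++ [x]))))) := by
      have : c + k + 1 + 1 = 1 + (c + (1 + k)) := by omega
      rw [this]
      simp only [List.replicate_add, List.replicate_one, List.append_assoc, List.cons_append, List.nil_append]
    rw [e1, e2]
    iterate 6 rw [wordHammingDist_append (by simp)]
    simp [wordHammingDist_self, wordHammingDist_cons, hx.symm, hx, hy, hy.symm]

theorem OuterPair.wordHammingDist_alternating (h : OuterPair x y) (a b c d e t : ℕ) :
    wordHammingDist (alternating x y (a + (t + 1)) b c (d + 2 * (t + 1)) e)
      (alternating x y a (b + 2 * (t + 1)) c d (e + (t + 1))) ∈ ({7, 8} : Set ℕ) := by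
  have e1 : alternating x y (a + (t + 1)) b c (d + 2 * (t + 1)) e =
      List.replicate a 1 ++ ((List.replicate (t + 1) 1 ++ [x]) ++ (List.replicate b 1 ++
        ((y :: (List.replicate c 1 ++ x :: List.replicate (t + 1) 1)) ++ (List.replicate d 1 ++
        ((List.replicate (t + 1) 1 ++ [y]) ++ List.replicate e 1))))) := by
    have : d + 2 * (t + 1) = (t + 1) + (d + (t + 1)) := by omega
    rw [this, alternating]
    simp only [List.replicate_add, List.replicate_one, List.append_assoc, List.cons_append, List.nil_append]
  have e2 : alternating x y a (b + 2 * (t + 1)) c d (e + (t + 1)) =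
      List.replicate a 1 ++ ((x :: List.replicate (t + 1) 1) ++ (List.replicate b 1 ++
        ((List.replicate (t + 1) 1 ++ y :: (List.replicate c 1 ++ [x])) ++ (List.replicate d 1 ++
        ((y :: List.replicate (t + 1) 1) ++ List.replicate e 1))))) := by
    have : b + 2 * (t + 1) = (t + 1) + (b + (t + 1)) := by omega
    rw [this, Nat.add_comm e, alternating]
    simp only [List.replicate_add, List.replicate_one, List.append_assoc, List.cons_append, List.nil_append]
  rw [e1, e2]
  iterate 6 rw [wordHammingDist_append (by simp; try omega)]
  simp only [wordHammingDist_self, wordHammingDist_move h.left, wordHammingDist_move h.right]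
  have := h.wordHammingDist_middle c t
  simp only [Set.mem_insert_iff, Set.mem_singleton_iff] at this ⊢
  omega

/-- The invariants leave only a free: raising a by t + 1 lowers b by 2(t + 1), raises d by as much
and lowers e by t + 1. -/
theorem OuterPair.wordHammingDist_mem (h : OuterPair x y) {a b c d e a' b' c' d' e' : ℕ}
    (hm : MEquiv (alternating x y a b c d e) (alternating x y a' b' c' d' e'))
    (hne : alternating x y a b c d e ≠ alternating x y a' b' c' d' e') :
    wordHammingDist (alternating x y a b c d e) (alternating x y a' b' c' d' e') ∈
      ({7, 8} : Set ℕ) := by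
  have rel : c = c' ∧ a + e = a' + e' ∧ 2 * a + b = 2 * a' + b' ∧ b + d = b' + d' := by
    rw [mEquiv_iff] at hm
    rcases h.cases with ⟨rfl, rfl⟩ | ⟨rfl, rfl⟩
    · simp [alternating, abCount, bcCount, abcCount, abCount_append, bcCount_append,
        abcCount_append, abCount_replicate_one, bcCount_replicate_one, abcCount_replicate_one,
        List.count_replicate] at hm
      omega
    · simp [alternating, abCount, bcCount, abcCount, abCount_append, bcCount_append,
        abcCount_append, abCount_replicate_one, bcCount_replicate_one, abcCount_replicate_one,
        List.count_replicate] at hm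
      omega
  obtain ⟨rfl, r1, r2, r3⟩ := rel
  rcases Nat.lt_trichotomy a a' with hlt | rfl | hlt
  · obtain ⟨t, rfl⟩ := Nat.exists_eq_add_of_lt hlt
    obtain rfl : b = b' + 2 * (t + 1) := by omega
    obtain rfl : d' = d + 2 * (t + 1) := by omega
    obtain rfl : e = e' + (t + 1) := by omega
    rw [wordHammingDist_comm]
    exact h.wordHammingDist_alternating a b' c d e' t
  · obtain rfl : b = b' := by omega
    obtain rfl : d = d' := by omega
    obtain rfl : e = e' := by omega
    exact absurd rfl hne
  · obtain ⟨t, rfl⟩ := Nat.exists_eq_add_of_lt hlt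
    obtain rfl : b' = b + 2 * (t + 1) := by omega
    obtain rfl : d = d' + 2 * (t + 1) := by omega
    obtain rfl : e' = e + (t + 1) := by omega
    exact h.wordHammingDist_alternating a' b c d' e t

/-- The c-heights minus the a-heights sum to b + d > 0 on the left and to -(b' + d') on the right.
-/
theorem not_mEquiv_alternating {a b c d e a' b' c' d' e' : ℕ} (hb : 0 < b) (hd : 0 < d) :
    ¬ MEquiv (alternating 0 2 a b c d e) (alternating 2 0 a' b' c' d' e') := by
  rw [mEquiv_iff]
  intro hm
  simp [alternating, abCount, bcCount, abcCount, abCount_append, bcCount_append,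
    abcCount_append, abCount_replicate_one, bcCount_replicate_one, abcCount_replicate_one,
    List.count_replicate] at hm
  omega

end alternating

/-! ### Stripping common ends and combining signs -/

namespace Sparse

variable {x y : Fin 3} {u v w : List (Fin 3)}

theorem head_eq (h : OuterPair x y) (hw : Sparse w) (h0 : 0 ∈ heights x w) :
    w.head? = some x := by
  cases w with
  | nil => simp [heights] at h0
  | cons l w =>
    rcases h.eq_or l with rfl | rfl | rfl
    · simp [heights_one_cons] at h0
    · rfl
    · exact absurd (by simp [heights_self_cons h.right]) (hw.disjoint_heights h h0)

theorem zero_mem_of_head (h : OuterPair x y) (h0 : w.head? = some x) : 0 ∈ heights x w := by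
  cases w with
  | nil => simp at h0
  | cons l w =>
    obtain rfl : l = x := by simpa using h0
    simp [heights_self_cons h.left]

theorem getLast_eq (h : OuterPair x y) (hw : Sparse w) (hB : w.count 1 ∈ heights x w) :
    w.getLast? = some x := by
  induction w using List.reverseRecOn with
  | nil => simp [heights] at hB
  | append_singleton w l =>
    rcases h.eq_or l with rfl | rfl | rfl
    · rcases mem_heights_append.1 hB with h1 | ⟨k, hk, -⟩
      · have := le_of_mem_heights h1
        simp at this
      · simp [heights] at hk
    · simp
    · refine absurd ?_ (hw.disjoint_heights h hB)
      have := mem_heights_split h.right w []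
      simpa [h.right] using this

end Sparse

namespace Sparse

variable {u v w : List (Fin 3)}

theorem outerPair_zero_two : OuterPair 0 2 := ⟨by decide, by decide, by decide⟩

theorem alternating_pos {x y : Fin 3} (h : OuterPair x y) {a b c d e : ℕ}
    (hw : Sparse (alternating x y a b c d e)) : 0 < b ∧ 0 < d := by
  constructor <;> refine Nat.pos_of_ne_zero ?_ <;> rintro rfl
  · exact not_adjacent h (p := List.replicate a 1) (by simpa [alternating] using hw)
  · exact not_adjacent h (p := List.replicate a 1 ++ x :: (List.replicate b 1 ++
      y :: List.replicate c 1)) (q := List.replicate e 1) (by simpa [alternating] using hw)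

/-- The case in which the transport of the letter `a` is nonnegative and that of the letter `c` is
nonpositive. -/
theorem wordHammingDist_mem_of_signs (hu : Sparse u) (hv : Sparse v) (h : MEquiv u v)
    (hhead : u.head? ≠ v.head?) (hlast : u.getLast? ≠ v.getLast?) {f g : ℕ → ℤ}
    (Tf : Transport (u.count 1) (heights 0 u) (heights 0 v) f)
    (Tg : Transport (u.count 1) (heights 2 u) (heights 2 v) g)
    (hf : ∀ i, 0 ≤ f i) (hf0 : ∃ i, f i ≠ 0) (hg : ∀ i, g i ≤ 0) (hg0 : ∃ i, g i ≠ 0) :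
    wordHammingDist u v ∈ ({7, 8} : Set ℕ) := by
  have hp := outerPair_zero_two
  obtain ⟨c0, c1, c2, -⟩ := mEquiv_iff.1 h
  -- An outer letter at height 0 (or at the top height) must be the first (or last) letter, and the
  -- two words differ there.
  have ends : ∀ {x y : Fin 3}, OuterPair x y → (0 ∈ heights x u → 0 ∉ heights x v) ∧
      (u.count 1 ∈ heights x u → u.count 1 ∉ heights x v) := fun hxy =>
    ⟨fun h1 h2 => hhead ((hu.head_eq hxy h1).trans (hv.head_eq hxy h2).symm),
      fun h1 h2 => hlast ((hu.getLast_eq hxy h1).trans (hv.getLast_eq hxy (c1 ▸ h2)).symm)⟩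
  have Ru := hu.rigid_heights hp
  have Su := hu.rigid_heights hp.symm
  have Rv := hv.rigid_heights hp
  have Sv := hv.rigid_heights hp.symm
  rw [← c1] at Rv Sv
  obtain ⟨l1, p, hpC, q, hqC, x, hxA, z, hzA, hpx, hxq, hz⟩ := Tf.length_eq_two Tg Ru Su Sv hf hf0
    (hg0.imp fun i hi => lt_of_le_of_ne (hg i) hi) (ends hp).1 (ends hp).2
  obtain ⟨l2, p', hpC', q', hqC', x', hxA', z', hzA', hpx', hxq', hz'⟩ :=
    -- Reversing the transport and exchanging a with c gives the same signs, now with the c's of v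
    -- as the two-element multiset.
    Tg.neg.length_eq_two Tf.neg Sv Rv Ru (by simpa using hg) (by simpa using hg0)
      (hf0.imp fun i hi => by simpa using lt_of_le_of_ne (hf i) (Ne.symm hi))
      (fun h1 h2 => (ends hp.symm).1 h2 h1) (fun h1 h2 => (ends hp.symm).2 h2 h1)
  rw [length_heights hp.left] at l1
  rw [length_heights hp.right] at l2
  rcases hz with hz | hz
  · obtain ⟨a, b, c, d, e, hue⟩ := hp.symm.exists_eq_alternating (c2.trans l2) l1 hpC hxA hqC hzA
      hpx hxq hz
    rcases hz' with hz' | hz'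
    · obtain ⟨a', b', c', d', e', hve⟩ := hp.exists_eq_alternating (c0 ▸ l1) l2 hpC' hxA' hqC' hzA'
        hpx' hxq' hz'
      subst hue hve
      obtain ⟨g1, g2⟩ := hv.alternating_pos hp
      exact absurd h.symm (not_mEquiv_alternating g1 g2)
    · obtain ⟨a', b', c', d', e', hve⟩ := hp.symm.exists_eq_alternating l2 (c0 ▸ l1) hzA' hpC' hxA'
        hqC' hz' hpx' hxq'
      subst hue hve
      exact hp.symm.wordHammingDist_mem h fun h1 => hhead (by rw [h1])
  · obtain ⟨a, b, c, d, e, hue⟩ := hp.exists_eq_alternating l1 (c2.trans l2) hzA hpC hxA hqC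
      hz hpx hxq
    rcases hz' with hz' | hz'
    · obtain ⟨a', b', c', d', e', hve⟩ := hp.exists_eq_alternating (c0 ▸ l1) l2 hpC' hxA' hqC' hzA'
        hpx' hxq' hz'
      subst hue hve
      exact hp.wordHammingDist_mem h fun h1 => hhead (by rw [h1])
    · obtain ⟨a', b', c', d', e', hve⟩ := hp.symm.exists_eq_alternating l2 (c0 ▸ l1) hzA' hpC' hxA'
        hqC' hz' hpx' hxq'
      subst hue hve
      obtain ⟨g1, g2⟩ := hu.alternating_pos hp
      exact absurd h (not_mEquiv_alternating g1 g2)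

theorem wordHammingDist_mem_of_reduced (hu : Sparse u) (h : MEquiv u v)
    (hhead : u.head? ≠ v.head?) (hlast : u.getLast? ≠ v.getLast?) :
    wordHammingDist u v ∈ ({7, 8} : Set ℕ) := by
  have hp := outerPair_zero_two
  have hv := hu.of_mEquiv h
  obtain ⟨c0, c1, c2, -, -, c5⟩ := mEquiv_iff.1 h
  have Ru := hu.rigid_heights hp
  have Su := hu.rigid_heights hp.symm
  have Rv := hv.rigid_heights hp
  have Sv := hv.rigid_heights hp.symm
  rw [← c1] at Rv Sv
  have Tf := ramp_transport Ru.le Rv.le (h.length_heights hp.left) h.sum_heights_zero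
  have Tg := ramp_transport Su.le Sv.le (h.length_heights hp.right) h.sum_heights_two
  rw [abcCount_eq_sum_ramp, abcCount_eq_sum_ramp] at c5
  have e₁ := sum_ramp_sub_eq_zero (h.length_heights hp.right) h.sum_heights_two c5
  have e₂ := sum_ramp_sub_eq_zero (h.symm.length_heights hp.right) h.symm.sum_heights_two c5.symm
  set f : ℕ → ℤ := fun i => (ramp (heights 0 v) i : ℤ) - ramp (heights 0 u) i with hf
  set g : ℕ → ℤ := fun i => (ramp (heights 2 v) i : ℤ) - ramp (heights 2 u) i with hg
  have hf' : (fun i => (ramp (heights 0 u) i : ℤ) - ramp (heights 0 v) i) = -f := by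
    ext i; simp [hf]
  have hg' : (fun i => (ramp (heights 2 u) i : ℤ) - ramp (heights 2 v) i) = -g := by
    ext i; simp [hg]
  rw [hf', hg'] at e₂
  -- Equal heights would force equal first letters, since these are read off from which outer letter
  -- has height 0.
  have hzero : ¬ ((∀ i, f i = 0) ∧ ∀ i, g i = 0) := by
    rintro ⟨hf0, hg0⟩
    have hA : ∀ i, i ∈ heights 0 u ↔ i ∈ heights 0 v := fun i => by
      have := Tf.lap i
      rw [← List.count_pos_iff, ← List.count_pos_iff]
      simp only [hf0] at this
      omega
    have hC : ∀ i, i ∈ heights 2 u ↔ i ∈ heights 2 v := fun i => by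
      have := Tg.lap i
      rw [← List.count_pos_iff, ← List.count_pos_iff]
      simp only [hg0] at this
      omega
    have h0 : u.head? = some 0 ↔ v.head? = some 0 :=
      ⟨fun h => hv.head_eq hp ((hA 0).1 (zero_mem_of_head hp h)),
        fun h => hu.head_eq hp ((hA 0).2 (zero_mem_of_head hp h))⟩
    have h2 : u.head? = some 2 ↔ v.head? = some 2 :=
      ⟨fun h => hv.head_eq hp.symm ((hC 0).1 (zero_mem_of_head hp.symm h)),
        fun h => hu.head_eq hp.symm ((hC 0).2 (zero_mem_of_head hp.symm h))⟩
    have hl := h.length_eq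
    cases u with
    | nil => exact hhead (by rw [List.length_eq_zero_iff.1 hl.symm])
    | cons a u =>
      cases v with
      | nil => simp at hl
      | cons b v =>
        simp only [List.head?_cons, Option.some.injEq, ne_eq] at h0 h2 hhead
        revert h0 h2 hhead
        clear * -
        revert a b
        decide
  have neg_sum : ∀ (D : List ℕ) (k : ℕ → ℤ), (D.map (-k)).sum = -(D.map k).sum := by
    intro D k
    induction D with
    | nil => rfl
    | cons d D ih => simp [ih]; ring
  rw [neg_sum, neg_sum] at e₂
  have hnonneg : ¬ ((∀ i, 0 ≤ f i) ∧ ∀ i, 0 ≤ g i) := fun hc =>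
    hzero (Tf.eq_zero_of_nonneg Tg Ru Su e₁ (by linarith) hc.1 hc.2)
  have hnonpos : ¬ ((∀ i, f i ≤ 0) ∧ ∀ i, g i ≤ 0) := fun hc => by
    have := Tf.neg.eq_zero_of_nonneg Tg.neg Rv Sv (by rw [neg_sum, neg_sum]; linarith)
      (by rw [neg_sum, neg_sum]; linarith) (by simpa using hc.1) (by simpa using hc.2)
    exact hzero (by simpa using this)
  have hf0 : ∃ i, f i ≠ 0 := by
    by_contra! hc
    rcases Tg.nonneg_or_nonpos Su Sv with h1 | h1
    · exact hnonneg ⟨fun i => (hc i).ge, h1⟩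
    · exact hnonpos ⟨fun i => (hc i).le, h1⟩
  have hg0 : ∃ i, g i ≠ 0 := by
    by_contra! hc
    rcases Tf.nonneg_or_nonpos Ru Rv with h1 | h1
    · exact hnonneg ⟨h1, fun i => (hc i).ge⟩
    · exact hnonpos ⟨h1, fun i => (hc i).le⟩
  rcases Tf.nonneg_or_nonpos Ru Rv with h1 | h1 <;> rcases Tg.nonneg_or_nonpos Su Sv with h2 | h2
  · exact absurd ⟨h1, h2⟩ hnonneg
  · exact hu.wordHammingDist_mem_of_signs hv h hhead hlast Tf Tg h1 hf0 h2 hg0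
  · rw [wordHammingDist_comm]
    have Tf' := Tf.neg
    have Tg' := Tg.neg
    rw [c1] at Tf' Tg'
    exact hv.wordHammingDist_mem_of_signs hu h.symm hhead.symm hlast.symm Tf' Tg'
      (by simpa using h1) (by simpa using hf0) (by simpa using h2) (by simpa using hg0)
  · exact absurd ⟨h1, h2⟩ hnonpos

theorem wordHammingDist_mem (hu : Sparse u) (h : MEquiv u v) (hne : u ≠ v) :
    wordHammingDist u v ∈ ({7, 8} : Set ℕ) := by
  induction hn : u.length using Nat.strong_induction_on generalizing u v with
  | _ n ih =>
    subst hn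
    by_cases hhead : u.head? = v.head?
    · have hl := h.length_eq
      cases u with
      | nil => exact absurd (List.length_eq_zero_iff.1 hl.symm).symm hne
      | cons a u =>
        cases v with
        | nil => simp at hl
        | cons b v =>
          obtain rfl : a = b := by simpa using hhead
          simpa [wordHammingDist_cons] using
            ih u.length (by simp) hu.of_cons h.of_cons (by simpa using hne) rfl
    · by_cases hlast : u.getLast? = v.getLast?
      · have hl := h.length_eq
        cases u using List.reverseRecOn with
        | nil => exact absurd (List.length_eq_zero_iff.1 hl.symm).symm hne
        | append_singleton u a =>
          cases v using List.reverseRecOn with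
          | nil => simp at hl
          | append_singleton v b =>
            obtain rfl : a = b := by simpa using hlast
            have h' := h.of_concat
            have := ih u.length (by simp) hu.of_concat h' (by simpa using hne) rfl
            rwa [wordHammingDist_append h'.length_eq, wordHammingDist_self, Nat.add_zero]
      · exact hu.wordHammingDist_mem_of_reduced h hhead hlast

end Sparse

theorem theorem4p7 (w : List (Fin 3)) (hw : MAmbiguous w) :
    minHammingDist w ∈ ({2, 4, 7, 8} : Set ℕ) := by
  obtain ⟨⟨u, hu, v, hv, hne, hd⟩, hmin⟩ := isLeast_minHammingDist hw
  have huv : MEquiv u v := MEquiv.trans (MEquiv.symm hu) hv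
  by_cases h4 : minHammingDist w ≤ 4
  · have h0 := huv.wordHammingDist_ne_zero hne
    have h1 := huv.wordHammingDist_ne_one
    have h3 := huv.wordHammingDist_ne_three
    rw [hd] at h0 h1 h3
    simp only [Set.mem_insert_iff, Set.mem_singleton_iff]
    omega
  · have hs : Sparse w := fun a b ha hb hab =>
      lt_of_lt_of_le (not_le.1 h4) (hmin ⟨a, ha, b, hb, hab, rfl⟩)
    have := (hs.of_mEquiv hu).wordHammingDist_mem huv hne
    rw [hd] at this
    rcases this with h | h <;> rw [h] <;> simp
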